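/- Let $d\ge 1$ be an integer and write $\langle x\rangle=(1+|x|^2)^{1/2}$ and $\widehat f(\xi)=(2\pi)^{-d/2}\int_{\mathbf R^d} f(x)e^{-i\langle x,\xi\rangle}\,dx$ (extended to $\mathscr S'(\mathbf R^d)$ by duality). For $p\in[1,\infty]$ let $p'\in[1,\infty]$ be the conjugate exponent, $1/p+1/p'=1$. For $p,q\in[1,\infty]$ and $s,t\in\mathbf R$ let $\mathscr FL^q_s$ be the space of all $f\in\mathscr S'(\mathbf R^d)$ with $\|f\|_{\mathscr FL^q_s}=\|\widehat f\,\langle\cdot\rangle^s\|_{L^q}<\infty$. Fix a window $\phi\in\mathscr S(\mathbf R^d)\setminus\{0\}$, let $V_\phi f(x,\xi)$ be the value at $\xi$ of the Fourier transform of $f\,\overline{\phi(\cdot-x)}$, and let $M^{p,q}_{s,t}$ and $W^{p,q}_{s,t}$ be the spaces of all $f\in\mathscr S'(\mathbf R^d)$ for which, respectively, $$\|f\|_{M^{p,q}_{s,t}}=\Big(\int\Big(\int|V_\phi f(x,\xi)\langle x\rangle^t\langle\xi\rangle^s|^p\,dx\Big)^{q/p}d\xi\Big)^{1/q},\qquad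 \|f\|_{W^{p,q}_{s,t}}=\Big(\int\Big(\int|V_\phi f(x,\xi)\langle x\rangle^t\langle\xi\rangle^s|^q\,d\xi\Big)^{p/q}dx\Big)^{1/p}$$ is finite (with the usual modification when an exponent is $\infty$). Let $p_j,q_j\in[1,\infty]$ and $s_j,t_j\in\mathbf R$, $j=0,1,2$, and set $\mathsf R(q)=2-\frac1{q_0}-\frac1{q_1}-\frac1{q_2}$. Assume that at least one of the following statements holds: 1. the map $(f_1,f_2)\mapsto f_1\cdot f_2$ on $\mathscr S(\mathbf R^d)\times\mathscr S(\mathbf R^d)$ extends to a continuous map from $\mathscr FL^{q_1}_{s_1}\times\mathscr FL^{q_2}_{s_2}$ to $\mathscr FL^{q_0'}_{-s_0}$; 2. the map $(f_1,f_2)\mapsto f_1\cdot f_2$ on $\mathscr S(\mathbf R^d)\times\mathscr S(\mathbf R^d)$ extends to a continuous map from $M^{p_1,q_1}_{s_1,t_1}\times M^{p_2,q_2}_{s_2,t_2}$ to $M^{p_0',q_0'}_{-s_0,-t_0}$; 3. the map $(f_1,f_2)\mapsto f_1\cdot f_2$ on $\mathscr S(\mathbf R^d)\times\mathscr S(\mathbf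 R^d)$ extends to a continuous map from $W^{p_1,q_1}_{s_1,t_1}\times W^{p_2,q_2}_{s_2,t_2}$ to $W^{p_0',q_0'}_{-s_0,-t_0}$. Then $s_j+s_k\ge 0$ for all $j,k\in\{0,1,2\}$ with $j\neq k$, and $s_0+s_1+s_2\ge d\cdot\mathsf R(q)$. -/

import Mathlib

open scoped ENNReal SchwartzMap

noncomputable section

/-- Euclidean space `ℝᵈ`. -/
abbrev Rd (d : ℕ) : Type := EuclideanSpace ℝ (Fin d)

namespace FourierMod

variable {d : ℕ}

/-- The weight `⟨x⟩ ^ s = (1 + |x|²) ^ (s / 2)`. -/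
def bracketPow (s : ℝ) (x : Rd d) : ℝ := Real.sqrt (1 + ‖x‖ ^ 2) ^ s

theorem bracketPow_eq (s : ℝ) :
    (bracketPow s : Rd d → ℝ) = fun x ↦ (1 + ‖x‖ ^ 2) ^ (s / 2) := by
  funext x
  rw [bracketPow, Real.sqrt_eq_rpow, ← Real.rpow_mul (by positivity)]
  congr 1
  ring

theorem bracketPow_hasTemperateGrowth (s : ℝ) :
    (fun x : Rd d ↦ (bracketPow s x : ℂ)).HasTemperateGrowth := by
  have h : (bracketPow s : Rd d → ℝ).HasTemperateGrowth := by
    rw [bracketPow_eq]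
    exact Function.hasTemperateGrowth_one_add_norm_sq_rpow (Rd d) (s / 2)
  exact Function.Complex.hasTemperateGrowth_ofReal.comp h

/-! ### The Fourier transform, normalized as `(2π)^(-d/2) ∫ f(x) e^(-i⟨x,ξ⟩) dx` -/

/-- The dilation `ξ ↦ (2π)⁻¹ ξ`. -/
def dilation (d : ℕ) : Rd d ≃L[ℝ] Rd d :=
  ContinuousLinearEquiv.smulLeft
    (Units.mk0 ((2 * Real.pi)⁻¹ : ℝ) (inv_ne_zero (by positivity)))

/-- The constant `(2π)^(-d/2)`. -/
def fourierConst (d : ℕ) : ℝ := (2 * Real.pi) ^ (-(d : ℝ) / 2)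

/-- The Fourier transform on Schwartz functions; see `schwartzFourier_apply` for the formula. -/
def schwartzFourier (d : ℕ) : 𝓢(Rd d, ℂ) →L[ℂ] 𝓢(Rd d, ℂ) :=
  (fourierConst d : ℂ) •
    ((SchwartzMap.compCLMOfContinuousLinearEquiv ℂ (dilation d)).comp
      (SchwartzMap.fourierTransformCLM ℂ))

theorem schwartzFourier_apply (f : 𝓢(Rd d, ℂ)) (ξ : Rd d) :
    schwartzFourier d f ξ =
      (fourierConst d : ℂ) * ∫ x, f x * Complex.exp (-Complex.I * (inner ℝ x ξ : ℝ)) := by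
  simp only [schwartzFourier, smul_apply, ContinuousLinearMap.comp_apply,
    smul_eq_mul, SchwartzMap.compCLMOfContinuousLinearEquiv_apply,
    Function.comp_apply, SchwartzMap.fourierTransformCLM_apply, SchwartzMap.fourier_coe]
  rw [Real.fourier_eq']
  congr 1
  refine MeasureTheory.integral_congr_ae (Filter.Eventually.of_forall fun x ↦ ?_)
  have h : dilation d ξ = ((2 * Real.pi)⁻¹ : ℝ) • ξ := rfl
  have hpi : (Real.pi : ℂ) ≠ 0 := by exact_mod_cast Real.pi_ne_zero
  simp only [h, inner_smul_right, smul_eq_mul]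
  rw [mul_comm]
  congr 2
  push_cast
  field_simp

/-- The Fourier transform on tempered distributions: `⟨û, ψ⟩ = ⟨u, ψ̂⟩`. -/
def temperedFourier (d : ℕ) : 𝓢'(Rd d, ℂ) →L[ℂ] 𝓢'(Rd d, ℂ) :=
  PointwiseConvergenceCLM.precomp ℂ (schwartzFourier d)

/-- A Schwartz function `f` as the tempered distribution `ψ ↦ ∫ ψ f`. -/
def ofSchwartz (f : 𝓢(Rd d, ℂ)) : 𝓢'(Rd d, ℂ) :=
  SchwartzMap.toTemperedDistributionCLM (Rd d) ℂ MeasureTheory.volume f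

theorem ofSchwartz_apply (f ψ : 𝓢(Rd d, ℂ)) : ofSchwartz f ψ = ∫ x, ψ x * f x :=
  SchwartzMap.toTemperedDistributionCLM_apply_apply MeasureTheory.volume f ψ

/-! ### Fourier Lebesgue spaces -/

/-- The tempered distribution `u` is given by the function `g`, and `g ∈ L^q`. -/
def IsLqFunction (q : ℝ≥0∞) (u : 𝓢'(Rd d, ℂ)) (g : Rd d → ℂ) : Prop :=
  MeasureTheory.MemLp g q MeasureTheory.volume ∧ ∀ ψ : 𝓢(Rd d, ℂ), u ψ = ∫ x, ψ x * g x

/-- The norm `‖f̂ ⟨·⟩ ^ s‖_{L^q}` of `f ∈ 𝓢'` in the Fourier Lebesgue space `ℱL^q_s`, equal to `∞`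
when `f̂ ⟨·⟩ ^ s` is not an `L^q` function. (The function `g` below is unique up to null sets,
so the infimum is over at most one value.) The space `ℱL^q_s` is the set where it is finite. -/
def fourierLebesgueNorm (q : ℝ≥0∞) (s : ℝ) (f : 𝓢'(Rd d, ℂ)) : ℝ≥0∞ :=
  ⨅ (g : Rd d → ℂ)
    (_ : IsLqFunction q
      (TemperedDistribution.smulLeftCLM ℂ (fun ξ : Rd d ↦ (bracketPow s ξ : ℂ))
        (temperedFourier d f)) g),
    MeasureTheory.eLpNorm g q MeasureTheory.volume

/-! ### The short-time Fourier transform and modulation spaces -/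

/-- The character `y ↦ e^(-i⟨y,ξ⟩)`. -/
def character (ξ y : Rd d) : ℂ := Complex.exp (-Complex.I * (inner ℝ y ξ : ℝ))

theorem expNegI_hasTemperateGrowth :
    (fun r : ℝ ↦ Complex.exp (-Complex.I * (r : ℂ))).HasTemperateGrowth := by
  have key : ∀ n : ℕ, iteratedDeriv n (fun r : ℝ ↦ Complex.exp (-Complex.I * (r : ℂ))) =
      fun r : ℝ ↦ (-Complex.I) ^ n * Complex.exp (-Complex.I * (r : ℂ)) := by
    intro n
    induction n with
    | zero => simp
    | succ n ih =>
      rw [iteratedDeriv_succ, ih]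
      funext r
      have h₁ : HasDerivAt (fun r : ℝ ↦ -Complex.I * (r : ℂ)) (-Complex.I) r := by
        simpa using (Complex.ofRealCLM.hasDerivAt (x := r)).const_mul (-Complex.I)
      rw [(h₁.cexp.const_mul ((-Complex.I) ^ n)).deriv]
      ring
  refine ⟨?_, fun n ↦ ⟨0, 1, fun r ↦ ?_⟩⟩
  · exact (contDiff_const.mul Complex.ofRealCLM.contDiff).cexp
  · rw [norm_iteratedFDeriv_eq_norm_iteratedDeriv, key]
    simp [Complex.norm_exp]

theorem character_hasTemperateGrowth (ξ : Rd d) : (character ξ).HasTemperateGrowth :=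
  expNegI_hasTemperateGrowth.comp (Function.hasTemperateGrowth_inner_left ξ)

/-- The Schwartz function `y ↦ (2π)^(-d/2) conj (φ (y - x)) e^(-i⟨y,ξ⟩)`. -/
def stftAtom (φ : 𝓢(Rd d, ℂ)) (x ξ : Rd d) : 𝓢(Rd d, ℂ) :=
  (fourierConst d : ℂ) •
    SchwartzMap.smulLeftCLM ℂ (character ξ)
      (SchwartzMap.compSubConstCLM ℝ x
        (SchwartzMap.postcompCLM (Complex.conjCLE : ℂ →L[ℝ] ℂ) φ))

theorem stftAtom_apply (φ : 𝓢(Rd d, ℂ)) (x ξ y : Rd d) :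
    stftAtom φ x ξ y =
      (fourierConst d : ℂ) * (starRingEnd ℂ (φ (y - x)) *
        Complex.exp (-Complex.I * (inner ℝ y ξ : ℝ))) := by
  simp only [stftAtom, smul_apply, smul_eq_mul,
    SchwartzMap.smulLeftCLM_apply_apply (character_hasTemperateGrowth ξ),
    SchwartzMap.compSubConstCLM_apply, SchwartzMap.postcompCLM_apply]
  rw [mul_comm (character ξ y)]
  rfl

/-- The short-time Fourier transform `V_φ f (x, ξ)` of `f ∈ 𝓢'` with window `φ ∈ 𝓢`, that is the
value at `ξ` of the Fourier transform of `f · conj (φ (· - x))`. -/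
def stft (φ : 𝓢(Rd d, ℂ)) (f : 𝓢'(Rd d, ℂ)) (x ξ : Rd d) : ℂ := f (stftAtom φ x ξ)

/-- For Schwartz functions the short-time Fourier transform is given by the usual integral. -/
theorem stft_ofSchwartz (φ f : 𝓢(Rd d, ℂ)) (x ξ : Rd d) :
    stft φ (ofSchwartz f) x ξ =
      (fourierConst d : ℂ) * ∫ y, f y * starRingEnd ℂ (φ (y - x)) *
        Complex.exp (-Complex.I * (inner ℝ y ξ : ℝ)) := by
  rw [stft, ofSchwartz_apply, ← MeasureTheory.integral_const_mul]
  refine MeasureTheory.integral_congr_ae (Filter.Eventually.of_forall fun y ↦ ?_)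
  simp only [stftAtom_apply]
  ring

/-- `V_φ f (x, ξ) ⟨x⟩ ^ t ⟨ξ⟩ ^ s`. -/
def weightedStft (φ : 𝓢(Rd d, ℂ)) (s t : ℝ) (f : 𝓢'(Rd d, ℂ)) (x ξ : Rd d) : ℂ :=
  stft φ f x ξ * (bracketPow t x : ℂ) * (bracketPow s ξ : ℂ)

/-- The norm of `M^{p,q}_{s,t}` with window `φ`: first the `L^p` norm in `x`, then the `L^q` norm
in `ξ`. The space `M^{p,q}_{s,t}` is the set of `f ∈ 𝓢'` where it is finite. -/
def modulationNorm (φ : 𝓢(Rd d, ℂ)) (p q : ℝ≥0∞) (s t : ℝ) (f : 𝓢'(Rd d, ℂ)) : ℝ≥0∞ :=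
  MeasureTheory.eLpNorm
    (fun ξ : Rd d ↦
      MeasureTheory.eLpNorm (fun x : Rd d ↦ weightedStft φ s t f x ξ) p MeasureTheory.volume)
    q MeasureTheory.volume

/-- The norm of `W^{p,q}_{s,t}` with window `φ`: first the `L^q` norm in `ξ`, then the `L^p` norm
in `x`. The space `W^{p,q}_{s,t}` is the set of `f ∈ 𝓢'` where it is finite. -/
def wienerNorm (φ : 𝓢(Rd d, ℂ)) (p q : ℝ≥0∞) (s t : ℝ) (f : 𝓢'(Rd d, ℂ)) : ℝ≥0∞ :=
  MeasureTheory.eLpNorm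
    (fun x : Rd d ↦
      MeasureTheory.eLpNorm (fun ξ : Rd d ↦ weightedStft φ s t f x ξ) q MeasureTheory.volume)
    p MeasureTheory.volume

/-! ### Continuous extension of the product -/

/-- The pointwise product of two Schwartz functions. -/
def schwartzMul (f g : 𝓢(Rd d, ℂ)) : 𝓢(Rd d, ℂ) :=
  SchwartzMap.pairing (ContinuousLinearMap.mul ℂ ℂ) f g

theorem schwartzMul_apply (f g : 𝓢(Rd d, ℂ)) (x : Rd d) : schwartzMul f g x = f x * g x := rfl

/-- For norms `N₁`, `N₂`, `N₀` on tempered distributions (value `∞` off the normed space `X₁`, `X₂`,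
`X₀` they define), the product `(f, g) ↦ f g` on `𝓢` extends to a continuous map
`T : X₁ × X₂ → X₀`. Linearity or uniqueness of the extension is not required. -/
def ProductExtendsContinuously (N₁ N₂ N₀ : 𝓢'(Rd d, ℂ) → ℝ≥0∞) : Prop :=
  ∃ T : 𝓢'(Rd d, ℂ) → 𝓢'(Rd d, ℂ) → 𝓢'(Rd d, ℂ),
    (∀ u v, N₁ u < ∞ → N₂ v < ∞ → N₀ (T u v) < ∞) ∧
    (∀ u v, N₁ u < ∞ → N₂ v < ∞ → ∀ ε : ℝ≥0∞, 0 < ε → ∃ δ : ℝ≥0∞, 0 < δ ∧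
      ∀ u' v', N₁ u' < ∞ → N₂ v' < ∞ → N₁ (u' - u) < δ → N₂ (v' - v) < δ →
        N₀ (T u' v' - T u v) < ε) ∧
    ∀ f g : 𝓢(Rd d, ℂ), T (ofSchwartz f) (ofSchwartz g) = ofSchwartz (schwartzMul f g)

/-- The Young functional `R(q) = 2 - 1/q₀ - 1/q₁ - 1/q₂`, with `1/∞ = 0`. -/
def youngFunctional (q : Fin 3 → ℝ≥0∞) : ℝ :=
  2 - (q 0)⁻¹.toReal - (q 1)⁻¹.toReal - (q 2)⁻¹.toReal

end FourierMod

end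

noncomputable section

namespace FourierMod

open MeasureTheory

variable {d : ℕ}

/-! ### Characters and weights -/

/-! All three cases follow from one family of test functions. Let `B` be a smooth bump supported in
the ball of radius 1/2, with `B 0 = 1`, and let `H = profile B`. The function `f(y) = r^d e^(i⟨y,a⟩)
H(r y) B(y)` has a Fourier transform that is essentially a bump of height 1 filling a ball of radius
of order `r` about `a`. If the weight is comparable to its value at `a` on that ball, the `ℱL^q_s`
norm of `f` is at most a constant times `r^(d/q) ⟨a⟩^s` (`norm_windowedFourier_testFunction_le`).
The product of two such functions, centred at `a` and `b`, has a Fourier transform of height at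
least `c r^d` on a ball of radius of order `r` about `a + b` (`exists_lower_bound`).

The factor `B` keeps everything near the origin in space, uniformly in `r` and `a`. The short-time
Fourier transform is therefore controlled by a product of a fixed decaying function of `x` and the
same frequency profile, so that `p`, `t` and the order of the two norms only affect constants.
`IsAdaptedNorm` records these estimates, and it holds for all three families of norms.

Continuity at the origin and bilinearity on `𝓢` give a bound for products, which becomes `r^(d +
d/q₀') ⟨a+b⟩^(-s₀) ≤ C r^(d/q₁ + d/q₂) ⟨a⟩^(s₁) ⟨b⟩^(s₂)` (`IsAdaptedNorm.exists_bound`). With `r`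
fixed and `(a, b)` equal to `(x, -x)`, `(x, 0)` or `(0, x)`, letting `|x| → ∞` gives the three
pairwise conditions. With `a = b` and `r = |a| → ∞` it gives the condition on `s₀ + s₁ + s₂`
(`IsAdaptedNorm.necessary`). -/

theorem norm_character (ξ y : Rd d) : ‖character ξ y‖ = 1 := by
  simp [character, Complex.norm_exp]

theorem continuous_character (ξ : Rd d) : Continuous (character ξ) := by
  unfold character; fun_prop

theorem character_add (ξ η y : Rd d) : character (ξ + η) y = character ξ y * character η y := by
  simp only [character, inner_add_right, ← Complex.exp_add]
  congr 1; push_cast; ring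

theorem character_smul_left (r : ℝ) (ξ y : Rd d) : character (r • ξ) y = character ξ (r • y) := by
  simp only [character, inner_smul_left, inner_smul_right]
  simp

theorem character_comm (ξ y : Rd d) : character ξ y = character y ξ := by
  simp only [character, real_inner_comm]

theorem norm_character_sub_one_le (ξ y : Rd d) : ‖character ξ y - 1‖ ≤ ‖ξ‖ * ‖y‖ := by
  have h := Real.norm_exp_I_mul_ofReal_sub_one_le (x := -(inner ℝ y ξ : ℝ))
  have h2 : character ξ y = Complex.exp (Complex.I * ((-(inner ℝ y ξ : ℝ) : ℝ) : ℂ)) := by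
    simp [character]
  rw [h2]
  refine h.trans ?_
  rw [norm_neg, mul_comm]
  exact norm_inner_le_norm y ξ

theorem bracketPow_pos (s : ℝ) (x : Rd d) : 0 < bracketPow s x :=
  Real.rpow_pos_of_pos (Real.sqrt_pos.2 (by positivity)) s

theorem continuous_bracketPow (s : ℝ) : Continuous (bracketPow s : Rd d → ℝ) := by
  rw [bracketPow_eq]
  exact Continuous.rpow_const (by fun_prop) fun x ↦ Or.inl (by positivity)

theorem sqrt_one_add_norm_sq_add_le (x y : Rd d) :
    √(1 + ‖x + y‖ ^ 2) ≤ √(1 + ‖x‖ ^ 2) * (1 + ‖y‖) := by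
  have h1 : √(1 + ‖x‖ ^ 2) ^ 2 = 1 + ‖x‖ ^ 2 := Real.sq_sqrt (by positivity)
  have h2 : ‖x‖ ≤ √(1 + ‖x‖ ^ 2) := Real.le_sqrt_of_sq_le (by linarith)
  have h3 : 1 ≤ √(1 + ‖x‖ ^ 2) := Real.one_le_sqrt.2 (by nlinarith [norm_nonneg x])
  rw [Real.sqrt_le_left (by positivity)]
  have h4 : ‖x + y‖ ^ 2 ≤ (‖x‖ + ‖y‖) ^ 2 := by gcongr; exact norm_add_le x y
  have h5 : √(1 + ‖x‖ ^ 2) + ‖y‖ ≤ √(1 + ‖x‖ ^ 2) * (1 + ‖y‖) := by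
    nlinarith [norm_nonneg y]
  calc 1 + ‖x + y‖ ^ 2 ≤ (√(1 + ‖x‖ ^ 2) + ‖y‖) ^ 2 := by
        nlinarith [mul_le_mul_of_nonneg_right h2 (norm_nonneg y)]
    _ ≤ _ := by gcongr

/-- Peetre's inequality. -/
theorem bracketPow_add_le (s : ℝ) (x y : Rd d) :
    bracketPow s (x + y) ≤ bracketPow s x * (1 + ‖y‖) ^ |s| := by
  have hp : ∀ z : Rd d, 0 < √(1 + ‖z‖ ^ 2) := fun z ↦ Real.sqrt_pos.2 (by positivity)
  rcases le_total 0 s with hs | hs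
  · rw [abs_of_nonneg hs, bracketPow, bracketPow, ← Real.mul_rpow (hp x).le (by positivity)]
    exact Real.rpow_le_rpow (hp _).le (sqrt_one_add_norm_sq_add_le x y) hs
  -- For `s ≤ 0` the roles of `x` and `x + y` are exchanged before taking the decreasing power.
  · have h := sqrt_one_add_norm_sq_add_le (x + y) (-y)
    rw [add_neg_cancel_right, norm_neg] at h
    have h2 := Real.rpow_le_rpow_of_nonpos (hp x) h hs
    rw [Real.mul_rpow (hp _).le (by positivity)] at h2
    rw [abs_of_nonpos hs, Real.rpow_neg (by positivity), ← div_eq_mul_inv,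
      le_div_iff₀ (by positivity)]
    exact h2

theorem bracketPow_add_le_pow (s : ℝ) (x y : Rd d) :
    bracketPow s (x + y) ≤ bracketPow s x * (1 + ‖y‖) ^ ⌈|s|⌉₊ := by
  refine (bracketPow_add_le s x y).trans ?_
  have := bracketPow_pos s x
  rw [← Real.rpow_natCast]
  gcongr
  · linarith [norm_nonneg y]
  · exact Nat.le_ceil _

theorem bracketPow_zero (s : ℝ) : bracketPow s (0 : Rd d) = 1 := by simp [bracketPow]

theorem bracketPow_le_pow (s : ℝ) (y : Rd d) : bracketPow s y ≤ (1 + ‖y‖) ^ ⌈|s|⌉₊ := by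
  simpa [bracketPow_zero] using bracketPow_add_le_pow s 0 y

/-! ### The integrable weight `(1 + |x|)^(-(d+1))` -/

/-- The function `(1 + |x|)^(-(d+1))`, which belongs to every `L^q`. -/
def decayWeight (x : Rd d) : ℝ := ((1 + ‖x‖) ^ (d + 1))⁻¹

theorem decayWeight_pos (x : Rd d) : 0 < decayWeight x := by unfold decayWeight; positivity

theorem decayWeight_le_one (x : Rd d) : decayWeight x ≤ 1 :=
  inv_le_one_of_one_le₀ (one_le_pow₀ (by linarith [norm_nonneg x]))

theorem continuous_decayWeight : Continuous (decayWeight : Rd d → ℝ) := by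
  unfold decayWeight
  exact Continuous.inv₀ (by fun_prop) fun x ↦ by positivity

theorem integrable_decayWeight : Integrable (decayWeight : Rd d → ℝ) := by
  have h := integrable_one_add_norm (E := Rd d) (μ := volume) (r := (d + 1 : ℕ)) (by simp)
  refine h.congr (Filter.Eventually.of_forall fun x ↦ ?_)
  simp only [decayWeight]
  rw [Real.rpow_neg (by positivity), Real.rpow_natCast]

/-- The weight is at most 1, so for finite `q ≥ 1` its `q`-th power is dominated by the weight
itself. -/
theorem memLp_decayWeight {q : ℝ≥0∞} (hq : 1 ≤ q) :
    MemLp (decayWeight : Rd d → ℝ) q volume := by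
  rcases eq_or_ne q ∞ with rfl | hq'
  · exact memLp_top_of_bound continuous_decayWeight.aestronglyMeasurable 1
      (Filter.Eventually.of_forall fun x ↦ by
        rw [Real.norm_of_nonneg (decayWeight_pos x).le]; exact decayWeight_le_one x)
  · have hq1 : 1 ≤ q.toReal := by simpa using ENNReal.toReal_mono hq' hq
    rw [← integrable_norm_rpow_iff continuous_decayWeight.aestronglyMeasurable
      (one_pos.trans_le hq).ne' hq']
    refine integrable_decayWeight.mono'
      (continuous_decayWeight.norm.rpow_const fun x ↦
        Or.inl (by simpa using (decayWeight_pos x).ne')).aestronglyMeasurable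
      (Filter.Eventually.of_forall fun x ↦ ?_)
    have h0 := decayWeight_pos x
    rw [Real.norm_of_nonneg (by positivity), Real.norm_of_nonneg h0.le]
    exact (Real.rpow_le_rpow_of_exponent_ge h0 (decayWeight_le_one x) hq1).trans_eq
      (Real.rpow_one _)

theorem eLpNorm_comp_smul_sub {q : ℝ≥0∞} {f : Rd d → ℝ} (hf : Continuous f)
    {r : ℝ} (hr : 0 < r) (a : Rd d) :
    eLpNorm (fun x ↦ f (r⁻¹ • (x - a))) q volume =
      ENNReal.ofReal (r ^ ((d : ℝ) * q⁻¹.toReal)) * eLpNorm f q volume := by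
  have hc : Continuous fun x : Rd d ↦ f (r⁻¹ • x) := by fun_prop
  have h1 := eLpNorm_comp_measurePreserving (p := q) hc.aestronglyMeasurable
    (measurePreserving_sub_right (volume : Measure (Rd d)) a)
  have hr' : r⁻¹ ≠ 0 := by positivity
  have h2 := eLpNorm_map_measure (p := q) (μ := (volume : Measure (Rd d)))
    (f := fun x : Rd d ↦ r⁻¹ • x) hf.aestronglyMeasurable (by fun_prop)
  rw [Measure.map_addHaar_smul _ hr', eLpNorm_smul_measure_of_ne_zero, inv_pow, inv_inv,
    abs_of_pos (by positivity), one_div, smul_eq_mul, finrank_euclideanSpace_fin] at h2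
  · refine h1.trans (h2.symm.trans ?_)
    rw [ENNReal.ofReal_rpow_of_pos (by positivity), ← Real.rpow_natCast, ← Real.rpow_mul hr.le]
  · exact (ENNReal.ofReal_pos.2 (abs_pos.2 (by positivity))).ne'

/-- Comparison with a constant on `S`. For `q = ∞` the exponent is 0, and the bound needs `S` not to
be a null set. -/
theorem le_eLpNorm_of_le_on {α : Type*} [MeasurableSpace α] {μ : Measure α} {ε : Type*}
    [TopologicalSpace ε] [ENormedAddMonoid ε] {q : ℝ≥0∞} (hq : q ≠ 0) {f : α → ε} {S : Set α}
    (hS : MeasurableSet S) (hS0 : μ S ≠ 0) {c : ℝ≥0∞} (h : ∀ x ∈ S, c ≤ ‖f x‖ₑ) :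
    c * μ S ^ q⁻¹.toReal ≤ eLpNorm f q μ := by
  have h1 := eLpNorm_indicator_const' (p := q) (c := c) hS hS0 hq
  rw [enorm_eq_self, one_div, ← ENNReal.toReal_inv] at h1
  rw [← h1]
  refine eLpNorm_mono_enorm fun x ↦ ?_
  by_cases hx : x ∈ S <;> simp [hx, h]

theorem conjExponent_ne_zero (q : ℝ≥0∞) : q.conjExponent ≠ 0 := by simp [ENNReal.conjExponent]

theorem toReal_inv_conjExponent {q : ℝ≥0∞} (hq : 1 ≤ q) :
    q.conjExponent⁻¹.toReal = 1 - q⁻¹.toReal := by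
  have h := (ENNReal.HolderConjugate.conjExponent hq).inv_add_inv_eq_one
  have h2 := congrArg ENNReal.toReal h
  rw [ENNReal.toReal_add (by simpa using (one_pos.trans_le hq).ne')
    (by simpa using conjExponent_ne_zero q), ENNReal.toReal_one] at h2
  linarith

/-! ### Test functions -/

/-- The unnormalized Fourier transform of `f w`. -/
def windowedFourier (f w : Rd d → ℂ) (ξ : Rd d) : ℂ := ∫ y, f y * w y * character ξ y

theorem fourierConst_pos (d : ℕ) : 0 < fourierConst d := Real.rpow_pos_of_pos (by positivity) _

theorem schwartzFourier_eq_windowedFourier (f : 𝓢(Rd d, ℂ)) (ξ : Rd d) :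
    schwartzFourier d f ξ = fourierConst d * windowedFourier f (fun _ ↦ 1) ξ := by
  simp [schwartzFourier_apply, windowedFourier, character]

theorem stft_ofSchwartz_eq_windowedFourier (φ f : 𝓢(Rd d, ℂ)) (x ξ : Rd d) :
    stft φ (ofSchwartz f) x ξ =
      fourierConst d * windowedFourier f (fun y ↦ starRingEnd ℂ (φ (y - x))) ξ :=
  stft_ofSchwartz φ f x ξ

/-- The function `z ↦ ∫ B(k) e^(-i⟨k,z⟩) dk`. -/
def profile (B : 𝓢(Rd d, ℂ)) : 𝓢(Rd d, ℂ) := (fourierConst d : ℂ)⁻¹ • schwartzFourier d B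

theorem profile_apply (B : 𝓢(Rd d, ℂ)) (z : Rd d) :
    profile B z = ∫ k, B k * character z k := by
  have h : (fourierConst d : ℂ) ≠ 0 := by exact_mod_cast (fourierConst_pos d).ne'
  simp [profile, schwartzFourier_eq_windowedFourier, windowedFourier, h]

/-- The function `y ↦ r^d e^(i⟨y,a⟩) H(r y) B(y)` with `H` the profile of `B`; its Fourier transform
is concentrated around `a` at scale `r`. -/
def testFunction (B : 𝓢(Rd d, ℂ)) (r : ℝ) (a : Rd d) : 𝓢(Rd d, ℂ) :=
  ((r : ℂ) ^ d) • SchwartzMap.smulLeftCLM ℂ (character (-a))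
    (SchwartzMap.smulLeftCLM ℂ (fun y ↦ profile B (r • y)) B)

theorem testFunction_apply (B : 𝓢(Rd d, ℂ)) (r : ℝ) (a y : Rd d) :
    testFunction B r a y = (r : ℂ) ^ d * (character (-a) y * (profile B (r • y) * B y)) := by
  have h : (fun y : Rd d ↦ profile B (r • y)).HasTemperateGrowth :=
    (profile B).hasTemperateGrowth.comp
      (r • ContinuousLinearMap.id ℝ (Rd d)).hasTemperateGrowth
  rw [testFunction, smul_apply,
    SchwartzMap.smulLeftCLM_apply_apply (character_hasTemperateGrowth _),
    SchwartzMap.smulLeftCLM_apply_apply h]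
  simp only [smul_eq_mul]

/-- Writing `H(r y)` as a superposition of the characters of frequency `r k` with density `B k` and
applying Fubini turns the transform into an average of translates of the transform of `B w`. -/
theorem windowedFourier_testFunction (B : 𝓢(Rd d, ℂ)) {w : Rd d → ℂ} (hw : Continuous w) {W : ℝ}
    (hW : ∀ y, ‖w y‖ ≤ W) (r : ℝ) (a ξ : Rd d) :
    windowedFourier (testFunction B r a) w ξ =
      (r : ℂ) ^ d * ∫ k, B k * windowedFourier B w (ξ - a + r • k) := by
  have hB : Integrable (B : Rd d → ℂ) := B.integrable
  have hBw : Integrable fun y ↦ B y * w y :=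
    hB.mul_bdd (c := W) hw.aestronglyMeasurable (Filter.Eventually.of_forall hW)
  have hint : Integrable (Function.uncurry fun (y k : Rd d) ↦
      B y * w y * B k * (character (ξ - a) y * character (r • y) k)) (volume.prod volume) := by
    refine (hBw.mul_prod hB).mul_bdd (c := 1) ?_ (Filter.Eventually.of_forall fun z ↦ ?_)
    · refine Continuous.aestronglyMeasurable ?_
      unfold character; fun_prop
    · simp [norm_character]
  have hl : windowedFourier (testFunction B r a) w ξ = (r : ℂ) ^ d *
      ∫ y, ∫ k, B y * w y * B k * (character (ξ - a) y * character (r • y) k) := by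
    rw [windowedFourier, ← integral_const_mul]
    congr 1; ext y
    have : ∀ k, B y * w y * B k * (character (ξ - a) y * character (r • y) k) =
        (B y * w y * character (ξ - a) y) * (B k * character (r • y) k) := fun k ↦ by ring
    simp_rw [this]
    rw [integral_const_mul, ← profile_apply, testFunction_apply, sub_eq_add_neg, character_add]
    ring
  rw [hl, integral_integral_swap hint]
  congr 2; ext k
  rw [windowedFourier, ← integral_const_mul]
  congr 1; ext y
  rw [character_add, character_smul_left r k, ← character_comm k]
  ring

/-- `B` is bounded, and the substitution `k ↦ r k` cancels the factor `r ^ d`. -/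
theorem integral_norm_mul_decay_le (B : 𝓢(Rd d, ℂ)) :
    ∃ C, 0 ≤ C ∧ ∀ (r : ℝ), 1 ≤ r → ∀ u : Rd d,
      r ^ d * ∫ k, ‖B k‖ * decayWeight (u + r • k) ≤ C := by
  obtain ⟨M, hM⟩ : ∃ M, ∀ k, ‖B k‖ ≤ M := ⟨_, SchwartzMap.norm_le_seminorm ℝ B⟩
  have hM0 : 0 ≤ M := (norm_nonneg _).trans (hM 0)
  have hJ0 : 0 ≤ ∫ k : Rd d, decayWeight k := integral_nonneg fun k ↦ (decayWeight_pos k).le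
  refine ⟨M * ∫ k : Rd d, decayWeight k, by positivity, fun r hr u ↦ ?_⟩
  have hr0 : 0 < r := by linarith
  have hi : Integrable fun k : Rd d ↦ decayWeight (u + r • k) :=
    (integrable_decayWeight.comp_add_left u).comp_smul hr0.ne'
  have h1 : ∫ k, ‖B k‖ * decayWeight (u + r • k) ≤ ∫ k, M * decayWeight (u + r • k) := by
    refine integral_mono_of_nonneg (Filter.Eventually.of_forall fun k ↦ ?_) (hi.const_mul M)
      (Filter.Eventually.of_forall fun k ↦ ?_)
    · exact mul_nonneg (norm_nonneg _) (decayWeight_pos _).le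
    · exact mul_le_mul_of_nonneg_right (hM k) (decayWeight_pos _).le
  rw [integral_const_mul,
    Measure.integral_comp_smul volume (fun k : Rd d ↦ decayWeight (u + k)) r,
    integral_add_left_eq_self (fun k : Rd d ↦ decayWeight k) u, finrank_euclideanSpace_fin,
    abs_of_pos (by positivity), smul_eq_mul] at h1
  calc r ^ d * ∫ k, ‖B k‖ * decayWeight (u + r • k)
      ≤ r ^ d * (M * ((r ^ d)⁻¹ * ∫ k : Rd d, decayWeight k)) := by gcongr
    _ = _ := by field_simp

/-- The powers of `1 + ‖η‖` in the decay hypothesis are spent three ways: `⌈|s|⌉₊` on Peetre's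
inequality, `d + 1` on the decay in `r⁻¹ • (ξ - a)`, and `d + 1` on integrability in `k`. The
constant `C` does not depend on `w`, so the window may be translated while `A` carries the
dependence on the translation. -/
theorem norm_windowedFourier_testFunction_le (B : 𝓢(Rd d, ℂ))
    (hB : ∀ k, 1 / 2 < ‖k‖ → B k = 0) (s : ℝ) :
    ∃ C, 0 ≤ C ∧ ∀ (w : Rd d → ℂ) (W A : ℝ) (a ξ : Rd d) (r K : ℝ), Continuous w →
      (∀ y, ‖w y‖ ≤ W) →
      (∀ η, ‖windowedFourier B w η‖ * (1 + ‖η‖) ^ (⌈|s|⌉₊ + 2 * (d + 1)) ≤ A) → 1 ≤ r →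
      (∀ k : Rd d, ‖k‖ ≤ 1 / 2 → bracketPow s (a + r • k) ≤ K * bracketPow s a) →
      ‖windowedFourier (testFunction B r a) w ξ‖ * bracketPow s ξ ≤
        C * A * K * bracketPow s a * decayWeight (r⁻¹ • (ξ - a)) := by
  obtain ⟨C, hC0, hC⟩ := integral_norm_mul_decay_le B
  refine ⟨2 ^ (d + 1) * C, by positivity, fun w W A a ξ r K hw hW hA hr hK ↦ ?_⟩
  have hr0 : 0 < r := by linarith
  have hA0 : 0 ≤ A := le_trans (by positivity) (hA 0)
  have ha := bracketPow_pos s a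
  have hK0 : 0 ≤ K := by
    have h := hK 0 (by simp)
    simp only [smul_zero, add_zero] at h
    by_contra! h2
    nlinarith [mul_neg_of_neg_of_pos h2 ha]
  set u := ξ - a with hu
  set n := ⌈|s|⌉₊
  -- the pointwise bound under the integral
  have hpt : ∀ k, ‖B k * windowedFourier B w (u + r • k)‖ * bracketPow s ξ ≤
      (2 ^ (d + 1) * A * K * bracketPow s a * decayWeight (r⁻¹ • u)) *
        (‖B k‖ * decayWeight (u + r • k)) := by
    intro k
    have hJ1 := decayWeight_pos (r⁻¹ • u)
    have hJ2 := decayWeight_pos (u + r • k)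
    rcases lt_or_ge (1 / 2) ‖k‖ with hk | hk
    · simp [hB k hk]
    have hk' : ‖-k‖ ≤ 1 / 2 := by rwa [norm_neg]
    -- Split `ξ = (a - r k) + (u + r k)`: the first point lies in the ball where `K` controls the
    -- weight, and Peetre's inequality handles the second.
    have h1 : bracketPow s ξ ≤ K * bracketPow s a * (1 + ‖u + r • k‖) ^ n := by
      have h := bracketPow_add_le_pow s (a + r • (-k)) (u + r • k)
      have e : a + r • (-k) + (u + r • k) = ξ := by rw [hu, smul_neg]; abel
      rw [e] at h
      exact h.trans (by gcongr; exact hK _ hk')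
    have h2 := hA (u + r • k)
    have h3 : 1 ≤ 2 ^ (d + 1) * decayWeight (r⁻¹ • u) * (1 + ‖u + r • k‖) ^ (d + 1) := by
      -- Since `r ≥ 1` and `‖k‖ ≤ 1/2`, decay in `u + r k` implies decay in `u / r`.
      have : 1 + ‖r⁻¹ • u‖ ≤ 2 * (1 + ‖u + r • k‖) := by
        have e : r⁻¹ • u = r⁻¹ • (u + r • k) + -k := by
          rw [smul_add, smul_smul, inv_mul_cancel₀ hr0.ne', one_smul]; abel
        have h4 : ‖r⁻¹ • (u + r • k)‖ ≤ ‖u + r • k‖ := by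
          rw [norm_smul, norm_inv, Real.norm_of_nonneg hr0.le]
          exact mul_le_of_le_one_left (norm_nonneg _) (inv_le_one_of_one_le₀ hr)
        have h5 := norm_add_le (r⁻¹ • (u + r • k)) (-k)
        rw [← e] at h5
        linarith [norm_nonneg (u + r • k)]
      have h6 := pow_le_pow_left₀ (by positivity) this (d + 1)
      rw [mul_pow] at h6
      rw [decayWeight, mul_assoc, mul_comm _⁻¹, ← mul_assoc, ← div_eq_mul_inv,
        one_le_div (by positivity)]
      exact h6
    have h4 : decayWeight (u + r • k) * (1 + ‖u + r • k‖) ^ (d + 1) = 1 := by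
      rw [decayWeight]; field_simp
    set V := ‖windowedFourier B w (u + r • k)‖
    set X := 1 + ‖u + r • k‖ with hX
    have hX0 : 0 < X := by positivity
    have hV0 : 0 ≤ V := norm_nonneg _
    have h5 : V * bracketPow s ξ ≤
        2 ^ (d + 1) * A * K * bracketPow s a * decayWeight (r⁻¹ • u) * decayWeight (u + r • k) :=
      calc V * bracketPow s ξ ≤ V * (K * bracketPow s a * X ^ n) * 1 := by
            rw [mul_one]; gcongr
        _ ≤ V * (K * bracketPow s a * X ^ n) *
              (2 ^ (d + 1) * decayWeight (r⁻¹ • u) * X ^ (d + 1)) := by gcongr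
        _ = V * (K * bracketPow s a * X ^ n) *
              (2 ^ (d + 1) * decayWeight (r⁻¹ • u) * X ^ (d + 1)) *
              (decayWeight (u + r • k) * X ^ (d + 1)) := by rw [h4, mul_one]
        _ = 2 ^ (d + 1) * (V * X ^ (n + 2 * (d + 1))) * K * bracketPow s a *
              decayWeight (r⁻¹ • u) * decayWeight (u + r • k) := by ring
        _ ≤ _ := by gcongr
    rw [norm_mul]
    calc ‖B k‖ * V * bracketPow s ξ = ‖B k‖ * (V * bracketPow s ξ) := by ring
      _ ≤ ‖B k‖ * (2 ^ (d + 1) * A * K * bracketPow s a * decayWeight (r⁻¹ • u) *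
            decayWeight (u + r • k)) := by gcongr
      _ = _ := by ring
  have hint : Integrable fun k ↦ ‖B k‖ * decayWeight (u + r • k) :=
    (B.integrable (μ := volume)).norm.mul_bdd (c := 1)
      (continuous_decayWeight.comp (by fun_prop)).aestronglyMeasurable
      (Filter.Eventually.of_forall fun k ↦ by
        rw [Real.norm_of_nonneg (decayWeight_pos _).le]; exact decayWeight_le_one _)
  rw [windowedFourier_testFunction B hw hW, norm_mul, norm_pow, Complex.norm_real,
    Real.norm_of_nonneg hr0.le]
  have hξ := bracketPow_pos s ξ
  have hJ1 := decayWeight_pos (r⁻¹ • u)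
  calc r ^ d * ‖∫ k, B k * windowedFourier B w (u + r • k)‖ * bracketPow s ξ
      ≤ r ^ d * (∫ k, ‖B k * windowedFourier B w (u + r • k)‖) * bracketPow s ξ := by
        gcongr; exact norm_integral_le_integral_norm _
    _ = r ^ d * ∫ k, ‖B k * windowedFourier B w (u + r • k)‖ * bracketPow s ξ := by
        rw [integral_mul_const]; ring
    _ ≤ r ^ d * ∫ k, (2 ^ (d + 1) * A * K * bracketPow s a * decayWeight (r⁻¹ • u)) *
          (‖B k‖ * decayWeight (u + r • k)) := by
        refine mul_le_mul_of_nonneg_left ?_ (by positivity)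
        exact integral_mono_of_nonneg (Filter.Eventually.of_forall fun k ↦ by positivity)
          (hint.const_mul _) (Filter.Eventually.of_forall hpt)
    _ = (2 ^ (d + 1) * A * K * bracketPow s a * decayWeight (r⁻¹ • u)) *
          (r ^ d * ∫ k, ‖B k‖ * decayWeight (u + r • k)) := by rw [integral_const_mul]; ring
    _ ≤ (2 ^ (d + 1) * A * K * bracketPow s a * decayWeight (r⁻¹ • u)) * C := by
        gcongr; exact hC r hr u
    _ = _ := by ring

/-- The product carries `r ^ (2d)`, and the substitution `z = r y` uses up one factor `r ^ d`. -/
theorem windowedFourier_mul_testFunction (B : 𝓢(Rd d, ℂ)) (w : Rd d → ℂ) {r : ℝ} (hr : 0 < r)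
    (a b η : Rd d) :
    windowedFourier (schwartzMul (testFunction B r a) (testFunction B r b)) w (a + b + r • η) =
      (r : ℂ) ^ d * ∫ z, profile B z ^ 2 * (B (r⁻¹ • z) ^ 2 * w (r⁻¹ • z) * character η z) := by
  have h := Measure.integral_comp_smul volume (fun z : Rd d ↦
    profile B z ^ 2 * (B (r⁻¹ • z) ^ 2 * w (r⁻¹ • z) * character η z)) r
  rw [finrank_euclideanSpace_fin, abs_of_pos (by positivity)] at h
  have hr' : (r : ℂ) ≠ 0 := by exact_mod_cast hr.ne'
  have h2 : (∫ z, profile B z ^ 2 * (B (r⁻¹ • z) ^ 2 * w (r⁻¹ • z) * character η z)) =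
      (r : ℂ) ^ d * ∫ y, profile B (r • y) ^ 2 * (B y ^ 2 * w y * character η (r • y)) := by
    simp only [smul_smul, inv_mul_cancel₀ hr.ne', one_smul] at h
    rw [h, Complex.real_smul]
    push_cast
    field_simp
  rw [h2, windowedFourier, ← integral_const_mul, ← integral_const_mul]
  congr 1; ext y
  have e1 : character a y * character (-a) y = 1 := by
    rw [← character_add, add_neg_cancel]; simp [character]
  have e2 : character b y * character (-b) y = 1 := by
    rw [← character_add, add_neg_cancel]; simp [character]
  rw [schwartzMul_apply, testFunction_apply, testFunction_apply, character_add, character_add,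
    character_smul_left]
  linear_combination ((r : ℂ) ^ d * (r : ℂ) ^ d * profile B (r • y) ^ 2 * B y ^ 2 * w y *
    character η (r • y)) * (character b y * character (-b) y * e1 + e2)

/-- `r ^ d H(r y) ^ 2` acts like a multiple of a point mass at 0, so the window enters only through
the value `w₀` of `B ^ 2 w` there. Replacing the window by this value costs `L / r`, and replacing
the character by 1 costs `‖η‖`, each against the first moment `m` of `|H| ^ 2`. -/
theorem norm_windowedFourier_mul_testFunction_sub_le (B : 𝓢(Rd d, ℂ)) :
    ∃ m, 0 ≤ m ∧ ∀ (w : Rd d → ℂ) (w₀ : ℂ) (L r : ℝ) (a b η : Rd d), Continuous w → 0 < r →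
      (∀ y, ‖B y ^ 2 * w y - w₀‖ ≤ L * ‖y‖) →
      ‖windowedFourier (schwartzMul (testFunction B r a) (testFunction B r b)) w
          (a + b + r • η) - (r : ℂ) ^ d * (w₀ * ∫ z, profile B z ^ 2)‖ ≤
        r ^ d * (m * (L * r⁻¹ + ‖w₀‖ * ‖η‖)) := by
  set H := profile B
  have hH2 : Integrable fun z ↦ H z ^ 2 := (schwartzMul H H).integrable.congr
    (Filter.Eventually.of_forall fun z ↦ by simp [schwartzMul_apply, sq])
  have hm : Integrable fun z ↦ ‖H z ^ 2‖ * ‖z‖ := by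
    have := (schwartzMul H H).integrable_pow_mul volume 1
    refine this.congr (Filter.Eventually.of_forall fun z ↦ ?_)
    simp [schwartzMul_apply, sq, mul_comm]
  refine ⟨∫ z, ‖H z ^ 2‖ * ‖z‖, integral_nonneg fun z ↦ by positivity,
    fun w w₀ L r a b η hw hr hL ↦ ?_⟩
  have hpt : ∀ z, ‖H z ^ 2 * (B (r⁻¹ • z) ^ 2 * w (r⁻¹ • z) * character η z) - w₀ * H z ^ 2‖ ≤
      (‖H z ^ 2‖ * ‖z‖) * (L * r⁻¹ + ‖w₀‖ * ‖η‖) := by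
    intro z
    have e : H z ^ 2 * (B (r⁻¹ • z) ^ 2 * w (r⁻¹ • z) * character η z) - w₀ * H z ^ 2 =
        H z ^ 2 * ((B (r⁻¹ • z) ^ 2 * w (r⁻¹ • z) - w₀) * character η z +
          w₀ * (character η z - 1)) := by ring
    have h1 := hL (r⁻¹ • z)
    rw [norm_smul, norm_inv, Real.norm_of_nonneg hr.le] at h1
    have h2 := norm_character_sub_one_le η z
    rw [e, norm_mul, mul_assoc]
    gcongr
    refine (norm_add_le _ _).trans ?_
    rw [norm_mul, norm_mul, norm_character, mul_one]
    calc _ ≤ L * (r⁻¹ * ‖z‖) + ‖w₀‖ * (‖η‖ * ‖z‖) := by gcongr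
      _ = _ := by ring
  have hi : Integrable fun z ↦
      H z ^ 2 * (B (r⁻¹ • z) ^ 2 * w (r⁻¹ • z) * character η z) - w₀ * H z ^ 2 := by
    refine (hm.mul_const (L * r⁻¹ + ‖w₀‖ * ‖η‖)).mono' ?_ (Filter.Eventually.of_forall hpt)
    have := continuous_character η
    have hB := B.continuous
    have hH := H.continuous
    exact Continuous.aestronglyMeasurable (by fun_prop)
  have hi2 : Integrable fun z ↦
      H z ^ 2 * (B (r⁻¹ • z) ^ 2 * w (r⁻¹ • z) * character η z) :=
    (hi.add (hH2.const_mul w₀)).congr (Filter.Eventually.of_forall fun z ↦ by simp)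
  rw [windowedFourier_mul_testFunction B w hr, ← mul_sub, ← integral_const_mul, ← integral_sub hi2
    (hH2.const_mul w₀), norm_mul, norm_pow, Complex.norm_real, Real.norm_of_nonneg hr.le,
    ← integral_mul_const]
  gcongr
  exact norm_integral_le_of_norm_le (hm.mul_const _) (Filter.Eventually.of_forall hpt)

/-! ### A bump function -/

/-- For `B` real and even the profile is real, so its square is `|H| ^ 2`. The integral is positive
because `H` is continuous and `H(0) = ∫ B > 0`. -/
theorem exists_bump (d : ℕ) : ∃ B : 𝓢(Rd d, ℂ), B 0 = 1 ∧ (∀ k, 1 / 2 < ‖k‖ → B k = 0) ∧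
    ∫ z, profile B z ^ 2 ≠ 0 := by
  let β : ContDiffBump (0 : Rd d) := ⟨1 / 4, 1 / 2, by norm_num, by norm_num⟩
  have hsupp : HasCompactSupport fun k ↦ (β k : ℂ) :=
    β.hasCompactSupport.comp_left (g := ((↑) : ℝ → ℂ)) Complex.ofReal_zero
  let B : 𝓢(Rd d, ℂ) := hsupp.toSchwartzMap (Complex.ofRealCLM.contDiff.comp β.contDiff)
  have hB : ∀ k, B k = (β k : ℂ) := fun k ↦ rfl
  refine ⟨B, ?_, fun k hk ↦ ?_, ?_⟩
  · rw [hB, β.one_of_mem_closedBall (by simp [β])]; simp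
  · rw [hB, β.zero_of_le_dist (by simpa [β] using hk.le)]; simp
  have hconj : ∀ z, starRingEnd ℂ (profile B z) = profile B z := by
    intro z
    rw [profile_apply, ← integral_conj, ← integral_neg_eq_self]
    congr 1; ext k
    rw [map_mul, hB, β.neg, hB, Complex.conj_ofReal]
    congr 1
    simp [character, ← Complex.exp_conj]
  have hsq : ∀ z, profile B z ^ 2 = ((‖profile B z‖ ^ 2 : ℝ) : ℂ) := by
    intro z
    rw [sq]
    nth_rw 2 [← hconj z]
    rw [Complex.mul_conj, Complex.normSq_eq_norm_sq]
  have h0 : profile B 0 ≠ 0 := by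
    have h1 : profile B 0 = ((∫ k, β k : ℝ) : ℂ) := by
      rw [profile_apply, ← integral_complex_ofReal]
      simp [character, hB]
    rw [h1]
    exact_mod_cast (β.integral_pos (μ := volume)).ne'
  simp_rw [hsq]
  rw [integral_complex_ofReal]
  have hi : Integrable fun z ↦ ‖profile B z‖ ^ 2 :=
    (schwartzMul (profile B) (profile B)).integrable.norm.congr
      (Filter.Eventually.of_forall fun z ↦ by simp [schwartzMul_apply, sq])
  have hpos : 0 < ∫ z, ‖profile B z‖ ^ 2 := by
    rw [integral_pos_iff_support_of_nonneg (fun z ↦ by positivity) hi]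
    have hc : Continuous fun z ↦ ‖profile B z‖ ^ 2 := by
      have := (profile B).continuous
      fun_prop
    exact hc.isOpen_support.measure_pos _ ⟨0, by simpa using h0⟩
  exact_mod_cast hpos.ne'

/-! ### Decay of the short-time Fourier transform of Schwartz functions -/

theorem integrable_mul_comp_sub_mul_character (f ψ : 𝓢(Rd d, ℂ)) (x ξ : Rd d) :
    Integrable fun y ↦ f y * ψ (y - x) * character ξ y := by
  have h := (schwartzMul f (SchwartzMap.compSubConstCLM ℝ x ψ)).integrable (μ := volume)
  exact h.mul_bdd (c := 1) (continuous_character ξ).aestronglyMeasurable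
    (Filter.Eventually.of_forall fun y ↦ (norm_character ξ y).le)

/-- Under the integral, `x j = y j - (y - x) j`; each term is absorbed into one of the two Schwartz
functions. -/
theorem coord_mul_windowedFourier (f ψ : 𝓢(Rd d, ℂ)) (x ξ : Rd d) (j : Fin d) :
    (x j : ℂ) * windowedFourier f (fun y ↦ ψ (y - x)) ξ =
      windowedFourier (SchwartzMap.smulLeftCLM ℂ (fun y : Rd d ↦ (y j : ℂ)) f)
          (fun y ↦ ψ (y - x)) ξ -
        windowedFourier f
          (fun y ↦ SchwartzMap.smulLeftCLM ℂ (fun y : Rd d ↦ (y j : ℂ)) ψ (y - x)) ξ := by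
  have hg : (fun y : Rd d ↦ (y j : ℂ)).HasTemperateGrowth :=
    Function.Complex.hasTemperateGrowth_ofReal.comp
      (EuclideanSpace.proj (𝕜 := ℝ) j).hasTemperateGrowth
  rw [windowedFourier, windowedFourier, windowedFourier, ← integral_const_mul, ← integral_sub
    (integrable_mul_comp_sub_mul_character _ _ x ξ) (integrable_mul_comp_sub_mul_character _ _ x ξ)]
  congr 1; ext y
  simp only [SchwartzMap.smulLeftCLM_apply_apply hg, smul_eq_mul, PiLp.sub_apply]
  push_cast
  ring

/-- Integration by parts in the direction `v`, with the derivative of the character supplying the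
factor `⟨v, ξ⟩`. -/
theorem inner_mul_windowedFourier (f ψ : 𝓢(Rd d, ℂ)) (x ξ v : Rd d) :
    Complex.I * (inner ℝ v ξ : ℝ) * windowedFourier f (fun y ↦ ψ (y - x)) ξ =
      windowedFourier (LineDeriv.lineDerivOp v f : 𝓢(Rd d, ℂ)) (fun y ↦ ψ (y - x)) ξ +
        windowedFourier f (fun y ↦ (LineDeriv.lineDerivOp v ψ : 𝓢(Rd d, ℂ)) (y - x)) ξ := by
  have hF : ∀ y, HasFDerivAt (fun y ↦ f y * ψ (y - x))
      (f y • fderiv ℝ ψ (y - x) + ψ (y - x) • fderiv ℝ f y) y := fun y ↦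
    (f.hasFDerivAt y).mul ((hasFDerivAt_comp_sub x).2 (ψ.hasFDerivAt (y - x)))
  have hχ : ∀ y, HasFDerivAt (character ξ)
      ((character ξ y) • ((-Complex.I) • Complex.ofRealCLM.comp (innerSL ℝ ξ))) y := fun y ↦ by
    have h : HasFDerivAt (fun y : Rd d ↦ -Complex.I * ((inner ℝ y ξ : ℝ) : ℂ))
        ((-Complex.I) • Complex.ofRealCLM.comp (innerSL ℝ ξ)) y := by
      have := (Complex.ofRealCLM.comp (innerSL ℝ ξ)).hasFDerivAt (x := y) |>.const_mul (-Complex.I)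
      simpa [real_inner_comm] using this
    exact h.cexp
  have e1 : ∀ y, fderiv ℝ (character ξ) y v =
      character ξ y * (-Complex.I * (inner ℝ v ξ : ℝ)) := fun y ↦ by
    rw [(hχ y).fderiv]; simp [real_inner_comm]
  have e2 : ∀ y, fderiv ℝ (fun y ↦ f y * ψ (y - x)) y v * character ξ y =
      (LineDeriv.lineDerivOp v f : 𝓢(Rd d, ℂ)) y * ψ (y - x) * character ξ y +
        f y * (LineDeriv.lineDerivOp v ψ : 𝓢(Rd d, ℂ)) (y - x) * character ξ y := fun y ↦ by
    rw [(hF y).fderiv]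
    simp only [SchwartzMap.lineDerivOp_apply_eq_fderiv, add_apply,
      smul_apply, smul_eq_mul]
    ring
  have i0 := integrable_mul_comp_sub_mul_character f ψ x ξ
  have i1 := integrable_mul_comp_sub_mul_character (LineDeriv.lineDerivOp v f) ψ x ξ
  have i2 := integrable_mul_comp_sub_mul_character f (LineDeriv.lineDerivOp v ψ) x ξ
  have h := integral_mul_fderiv_eq_neg_fderiv_mul_of_integrable (μ := volume) (v := v)
    (f := fun y ↦ f y * ψ (y - x)) (g := character ξ)
    ((i1.add i2).congr (Filter.Eventually.of_forall fun y ↦ (e2 y).symm))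
    ((i0.mul_const (-Complex.I * (inner ℝ v ξ : ℝ))).congr
      (Filter.Eventually.of_forall fun y ↦ by simp only [e1]; ring)) i0
    (fun y _ ↦ (hF y).differentiableAt) (fun y _ ↦ (hχ y).differentiableAt)
  simp_rw [e1, e2] at h
  rw [integral_add i1 i2] at h
  simp only [windowedFourier]
  have h3 : ∫ y, f y * ψ (y - x) * (character ξ y * (-Complex.I * (inner ℝ v ξ : ℝ))) =
      (-Complex.I * (inner ℝ v ξ : ℝ)) * ∫ y, f y * ψ (y - x) * character ξ y := by
    rw [← integral_const_mul]
    congr 1; ext y; ring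
  rw [h3] at h
  linear_combination -h

theorem norm_le_sum_abs_coord (x : Rd d) : ‖x‖ ≤ ∑ j, |x j| := by
  rw [EuclideanSpace.norm_eq, Real.sqrt_le_left (Finset.sum_nonneg fun j _ ↦ abs_nonneg _)]
  simp only [Real.norm_eq_abs]
  exact Finset.sum_sq_le_sq_sum_of_nonneg fun j _ ↦ abs_nonneg _

theorem mul_one_add_norm_le {V A : ℝ} {C : Fin d → ℝ} {x : Rd d} (hV : 0 ≤ V) (hA : V ≤ A)
    (hC : ∀ j, |x j| * V ≤ C j) : V * (1 + ‖x‖) ≤ A + ∑ j, C j :=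
  calc V * (1 + ‖x‖) = V + V * ‖x‖ := by ring
    _ ≤ A + V * ∑ j, |x j| := by gcongr; exact norm_le_sum_abs_coord x
    _ = A + ∑ j, |x j| * V := by rw [Finset.mul_sum]; simp_rw [mul_comm V]
    _ ≤ _ := by gcongr with j _; exact hC j

/-- Each power of `1 + ‖ξ‖` is traded for a derivative of `f` or `ψ`. The induction is over all
pairs, since the pair changes at each step. -/
theorem exists_windowedFourier_decay_right (n : ℕ) (f ψ : 𝓢(Rd d, ℂ)) :
    ∃ A, ∀ x ξ, ‖windowedFourier f (fun y ↦ ψ (y - x)) ξ‖ * (1 + ‖ξ‖) ^ n ≤ A := by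
  induction n generalizing f ψ with
  | zero =>
    refine ⟨(∫ y, ‖f y‖) * SchwartzMap.seminorm ℝ 0 0 ψ, fun x ξ ↦ ?_⟩
    simp only [pow_zero, mul_one, windowedFourier]
    rw [← integral_mul_const]
    refine norm_integral_le_of_norm_le (f.integrable.norm.mul_const _)
      (Filter.Eventually.of_forall fun y ↦ ?_)
    rw [norm_mul, norm_mul, norm_character, mul_one]
    gcongr
    exact SchwartzMap.norm_le_seminorm ℝ ψ _
  | succ n ih =>
    obtain ⟨A, hA⟩ := ih f ψ
    choose C hC using fun j : Fin d ↦
      ih (LineDeriv.lineDerivOp (EuclideanSpace.single j (1 : ℝ)) f) ψ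
    choose D hD using fun j : Fin d ↦
      ih f (LineDeriv.lineDerivOp (EuclideanSpace.single j (1 : ℝ)) ψ)
    refine ⟨A + ∑ j, (C j + D j), fun x ξ ↦ ?_⟩
    rw [pow_succ, ← mul_assoc]
    refine mul_one_add_norm_le (by positivity) (hA x ξ) fun j ↦ ?_
    have h := congrArg norm (inner_mul_windowedFourier f ψ x ξ (EuclideanSpace.single j (1 : ℝ)))
    have e : (inner ℝ (EuclideanSpace.single j (1 : ℝ)) ξ : ℝ) = ξ j := by
      simp [EuclideanSpace.inner_single_left]
    rw [norm_mul, norm_mul, Complex.norm_I, Complex.norm_real, one_mul, e, Real.norm_eq_abs] at h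
    rw [← mul_assoc, h]
    refine (mul_le_mul_of_nonneg_right (norm_add_le _ _) (by positivity)).trans ?_
    rw [add_mul]
    exact add_le_add (hC j x ξ) (hD j x ξ)

theorem exists_windowedFourier_decay (m n : ℕ) (f ψ : 𝓢(Rd d, ℂ)) :
    ∃ A, ∀ x ξ, ‖windowedFourier f (fun y ↦ ψ (y - x)) ξ‖ * (1 + ‖ξ‖) ^ n * (1 + ‖x‖) ^ m ≤ A := by
  induction m generalizing f ψ with
  | zero => simpa using exists_windowedFourier_decay_right n f ψ
  | succ m ih =>
    obtain ⟨A, hA⟩ := ih f ψ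
    choose C hC using fun j : Fin d ↦
      ih (SchwartzMap.smulLeftCLM ℂ (fun y : Rd d ↦ (y j : ℂ)) f) ψ
    choose D hD using fun j : Fin d ↦
      ih f (SchwartzMap.smulLeftCLM ℂ (fun y : Rd d ↦ (y j : ℂ)) ψ)
    refine ⟨A + ∑ j, (C j + D j), fun x ξ ↦ ?_⟩
    rw [pow_succ, ← mul_assoc]
    refine mul_one_add_norm_le (by positivity) (hA x ξ) fun j ↦ ?_
    have h := congrArg norm (coord_mul_windowedFourier f ψ x ξ j)
    rw [norm_mul, Complex.norm_real, Real.norm_eq_abs] at h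
    rw [← mul_assoc, ← mul_assoc, h]
    refine (mul_le_mul_of_nonneg_right (mul_le_mul_of_nonneg_right (norm_sub_le _ _)
      (by positivity)) (by positivity)).trans ?_
    rw [add_mul, add_mul]
    exact add_le_add (hC j x ξ) (hD j x ξ)

/-! ### Mixed norms -/

section Mixed

variable {α β : Type*} [MeasurableSpace α] [MeasurableSpace β] {μ : Measure α} {ν : Measure β}

theorem eLpNorm_const_mul_real (c : ℝ) (g : α → ℝ) (p : ℝ≥0∞) :
    eLpNorm (fun x ↦ c * g x) p μ = ‖c‖ₑ * eLpNorm g p μ :=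
  eLpNorm_const_smul c g p μ

/-- A bound by a product of functions of separate variables makes the mixed norm factor, whichever
variable is integrated first. -/
theorem eLpNorm_eLpNorm_le_of_norm_le {F : α → β → ℂ} {g : α → ℝ} {h : β → ℝ} {D : ℝ}
    (hF : ∀ x y, ‖F x y‖ ≤ D * g x * h y) (p q : ℝ≥0∞) (hg : eLpNorm g p μ ≠ ∞) :
    eLpNorm (fun y ↦ eLpNorm (fun x ↦ F x y) p μ) q ν ≤
      ‖D‖ₑ * eLpNorm g p μ * eLpNorm h q ν := by
  set G := eLpNorm g p μ with hG
  have hG' : ‖G.toReal‖ₑ = G := by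
    rw [Real.enorm_eq_ofReal ENNReal.toReal_nonneg, ENNReal.ofReal_toReal hg]
  have h1 : ∀ y, eLpNorm (fun x ↦ F x y) p μ ≤ ‖(D * G.toReal) * h y‖ₑ := by
    intro y
    have h2 : eLpNorm (fun x ↦ F x y) p μ ≤ eLpNorm (fun x ↦ (D * h y) * g x) p μ :=
      eLpNorm_mono_real fun x ↦ (hF x y).trans_eq (by ring)
    rw [eLpNorm_const_mul_real, ← hG] at h2
    refine h2.trans_eq ?_
    rw [enorm_mul, enorm_mul, enorm_mul, hG']
    ring
  have h3 : eLpNorm (fun y ↦ eLpNorm (fun x ↦ F x y) p μ) q ν ≤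
      eLpNorm (fun y ↦ (D * G.toReal) * h y) q ν :=
    eLpNorm_mono_enorm fun y ↦ by rw [enorm_eq_self]; exact h1 y
  rwa [eLpNorm_const_mul_real, enorm_mul, hG'] at h3

theorem le_eLpNorm_eLpNorm_of_le_on {F : α → β → ℂ} {S : Set α} {T : Set β} {c : ℝ≥0∞}
    {p q : ℝ≥0∞} (hp : p ≠ 0) (hq : q ≠ 0) (hS : MeasurableSet S) (hT : MeasurableSet T)
    (hS0 : μ S ≠ 0) (hT0 : ν T ≠ 0) (h : ∀ x ∈ S, ∀ y ∈ T, c ≤ ‖F x y‖ₑ) :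
    c * μ S ^ p⁻¹.toReal * ν T ^ q⁻¹.toReal ≤
      eLpNorm (fun y ↦ eLpNorm (fun x ↦ F x y) p μ) q ν := by
  refine le_eLpNorm_of_le_on hq hT hT0 fun y hy ↦ ?_
  rw [enorm_eq_self]
  exact le_eLpNorm_of_le_on hp hS hS0 fun x hx ↦ h x hx y hy

end Mixed

/-! ### Balls at scale `r` and the lower bound for products of test functions -/

theorem volume_closedBall_mul_rpow (a : Rd d) {r : ℝ} (hr : 0 < r) {ρ : ℝ} (hρ : 0 < ρ) {θ : ℝ}
    (hθ : 0 ≤ θ) :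
    volume (Metric.closedBall a (r * ρ)) ^ θ =
      ENNReal.ofReal (r ^ ((d : ℝ) * θ)) * volume (Metric.closedBall (0 : Rd d) ρ) ^ θ := by
  rw [Measure.addHaar_closedBall_mul volume a hr.le hρ.le, ENNReal.mul_rpow_of_nonneg _ _ hθ,
    finrank_euclideanSpace_fin, ENNReal.ofReal_rpow_of_pos (by positivity), ← Real.rpow_natCast,
    ← Real.rpow_mul hr.le]

theorem exists_pos_ofReal_le {X : ℝ≥0∞} (hX : X ≠ 0) : ∃ c : ℝ, 0 < c ∧ ENNReal.ofReal c ≤ X := by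
  -- The minimum with 1 covers the case `X = ∞`.
  have h : min X 1 ≠ ∞ := by simp
  refine ⟨(min X 1).toReal, ENNReal.toReal_pos (by simp [hX]) h, ?_⟩
  rw [ENNReal.ofReal_toReal h]
  exact min_le_left _ _

theorem exists_lipschitz (f : 𝓢(Rd d, ℂ)) : ∃ L, ∀ x y, ‖f x - f y‖ ≤ L * ‖x - y‖ := by
  obtain ⟨L, hL⟩ : ∃ L, ∀ x, ‖fderiv ℝ f x‖ ≤ L :=
    ⟨_, SchwartzMap.norm_le_seminorm ℝ (SchwartzMap.fderivCLM ℝ (Rd d) ℂ f)⟩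
  exact ⟨L, fun x y ↦
    convex_univ.norm_image_sub_le_of_norm_fderiv_le (fun z _ ↦ f.differentiableAt) (fun z _ ↦ hL z)
      trivial trivial⟩

/-- The constants depend on the window only through `L`, `M` and `δ`, so they are uniform over
translated windows. -/
theorem exists_lower_bound (B : 𝓢(Rd d, ℂ)) (hB : ∫ z, profile B z ^ 2 ≠ 0) (L M : ℝ) {δ : ℝ}
    (hδ : 0 < δ) : ∃ ρ r₀ c : ℝ, 0 < ρ ∧ ρ ≤ 1 / 2 ∧ 1 ≤ r₀ ∧ 0 < c ∧
      ∀ (w : Rd d → ℂ) (w₀ : ℂ) (r : ℝ) (a b η : Rd d), Continuous w →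
        (∀ y, ‖B y ^ 2 * w y - w₀‖ ≤ L * ‖y‖) → δ ≤ ‖w₀‖ → ‖w₀‖ ≤ M → r₀ ≤ r → ‖η‖ ≤ ρ →
        c * r ^ d ≤ ‖windowedFourier (schwartzMul (testFunction B r a) (testFunction B r b)) w
          (a + b + r • η)‖ := by
  obtain ⟨m, hm0, hm⟩ := norm_windowedFourier_mul_testFunction_sub_le B
  set I := ‖∫ z, profile B z ^ 2‖ with hI
  have hI0 : 0 < I := norm_pos_iff.2 hB
  have h4 : 0 < δ * I / 4 := by positivity
  -- The main term is at least `δ I r ^ d`. Large `r` and small `η` make each of the two errors at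
  -- most a quarter of this, leaving half.
  refine ⟨min (1 / 2) (δ * I / 4 / (m * |M| + 1)), max 1 ((m * |L|) / (δ * I / 4)), δ * I / 2,
    by positivity, min_le_left _ _, le_max_left _ _, by positivity,
    fun w w₀ r a b η hw hL hδw hM hr hη ↦ ?_⟩
  have hr1 : 1 ≤ r := (le_max_left _ _).trans hr
  have hr0 : 0 < r := by linarith
  have h := hm w w₀ L r a b η hw hr0 hL
  have e1 : m * (L * r⁻¹) ≤ δ * I / 4 := by
    have : m * |L| ≤ δ * I / 4 * r := by
      rw [mul_comm, ← div_le_iff₀' h4, mul_comm |L|]; exact (le_max_right _ _).trans hr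
    rw [← mul_assoc, ← div_eq_mul_inv, div_le_iff₀ hr0]
    exact le_trans (by gcongr; exact le_abs_self L) this
  have e2 : m * (‖w₀‖ * ‖η‖) ≤ δ * I / 4 := by
    have h5 : ‖η‖ * (m * |M| + 1) ≤ δ * I / 4 := by
      rw [← le_div_iff₀ (by positivity)]; exact hη.trans (min_le_right _ _)
    have h6 : ‖w₀‖ ≤ |M| := hM.trans (le_abs_self M)
    calc m * (‖w₀‖ * ‖η‖) ≤ m * (|M| * ‖η‖) := by gcongr
      _ ≤ ‖η‖ * (m * |M| + 1) := by nlinarith [norm_nonneg η]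
      _ ≤ _ := h5
  have e3 : r ^ d * (δ * I) ≤ ‖(r : ℂ) ^ d * (w₀ * ∫ z, profile B z ^ 2)‖ := by
    rw [norm_mul, norm_mul, norm_pow, Complex.norm_real, Real.norm_of_nonneg hr0.le, ← hI]
    gcongr
  have e4 := norm_sub_norm_le ((r : ℂ) ^ d * (w₀ * ∫ z, profile B z ^ 2))
    (windowedFourier (schwartzMul (testFunction B r a) (testFunction B r b)) w (a + b + r • η))
  rw [norm_sub_rev] at e4
  have e5 : r ^ d * (m * (L * r⁻¹ + ‖w₀‖ * ‖η‖)) ≤ r ^ d * (δ * I / 2) := by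
    gcongr; linarith
  linarith

/-! ### Norms adapted to the test functions -/

/-- The size of a norm on the test functions and on their products, as for the Fourier Lebesgue
space `ℱL^q_s`. -/
structure IsAdaptedNorm (B : 𝓢(Rd d, ℂ)) (N : 𝓢'(Rd d, ℂ) → ℝ≥0∞) (q : ℝ≥0∞) (s : ℝ) : Prop where
  smul : ∀ (c : ℂ) (f : 𝓢(Rd d, ℂ)), N (ofSchwartz (c • f)) ≤ ‖c‖ₑ * N (ofSchwartz f)
  upper : ∀ K : ℝ, ∃ C : ℝ, ∀ (r : ℝ) (a : Rd d), 1 ≤ r →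
    (∀ k : Rd d, ‖k‖ ≤ 1 / 2 → bracketPow s (a + r • k) ≤ K * bracketPow s a) →
    N (ofSchwartz (testFunction B r a)) ≤
      ENNReal.ofReal (C * (r ^ ((d : ℝ) * q⁻¹.toReal) * bracketPow s a))
  -- The threshold `r₀` precedes `K`, so that `K` may later be chosen in terms of `r₀`.
  lower : ∃ r₀ : ℝ, 1 ≤ r₀ ∧ ∀ K : ℝ, 0 < K → ∃ c : ℝ, 0 < c ∧ ∀ (r : ℝ) (a b : Rd d), r₀ ≤ r →
    (∀ k : Rd d, ‖k‖ ≤ 1 / 2 → bracketPow s (a + b) ≤ K * bracketPow s (a + b + r • k)) →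
    ENNReal.ofReal (c * (r ^ ((d : ℝ) + d * q⁻¹.toReal) * bracketPow s (a + b))) ≤
      N (ofSchwartz (schwartzMul (testFunction B r a) (testFunction B r b)))

/-! ### Necessary conditions for adapted norms -/

theorem ofSchwartz_smul (c : ℂ) (f : 𝓢(Rd d, ℂ)) : ofSchwartz (c • f) = c • ofSchwartz f :=
  map_smul (SchwartzMap.toTemperedDistributionCLM (Rd d) ℂ volume) c f

theorem ofSchwartz_zero : ofSchwartz (0 : 𝓢(Rd d, ℂ)) = 0 :=
  map_zero (SchwartzMap.toTemperedDistributionCLM (Rd d) ℂ volume)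

/-- The extension need not be bilinear, but the product on `𝓢` is, so continuity at the origin and
rescaling suffice. Positive upper bounds `X`, `Y` replace the norms themselves to avoid dividing by
zero. -/
theorem ProductExtendsContinuously.exists_bound {N₁ N₂ N₀ : 𝓢'(Rd d, ℂ) → ℝ≥0∞}
    (h : ProductExtendsContinuously N₁ N₂ N₀)
    (h₁ : ∀ (c : ℂ) (f : 𝓢(Rd d, ℂ)), N₁ (ofSchwartz (c • f)) ≤ ‖c‖ₑ * N₁ (ofSchwartz f))
    (h₂ : ∀ (c : ℂ) (f : 𝓢(Rd d, ℂ)), N₂ (ofSchwartz (c • f)) ≤ ‖c‖ₑ * N₂ (ofSchwartz f))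
    (h₀ : ∀ (c : ℂ) (f : 𝓢(Rd d, ℂ)), N₀ (ofSchwartz (c • f)) ≤ ‖c‖ₑ * N₀ (ofSchwartz f)) :
    ∃ M : ℝ, 0 < M ∧ ∀ (f g : 𝓢(Rd d, ℂ)) (X Y : ℝ), 0 < X → 0 < Y →
      N₁ (ofSchwartz f) ≤ ENNReal.ofReal X → N₂ (ofSchwartz g) ≤ ENNReal.ofReal Y →
      N₀ (ofSchwartz (schwartzMul f g)) ≤ ENNReal.ofReal (M * (X * Y)) := by
  obtain ⟨T, -, hT, hTmul⟩ := h
  have z₁ : N₁ 0 = 0 := by simpa [ofSchwartz_zero] using h₁ 0 0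
  have z₂ : N₂ 0 = 0 := by simpa [ofSchwartz_zero] using h₂ 0 0
  have hT0 : T 0 0 = 0 := by
    have h := hTmul 0 0
    have e : schwartzMul (0 : 𝓢(Rd d, ℂ)) 0 = 0 := by ext x; simp [schwartzMul_apply]
    rwa [e, ofSchwartz_zero] at h
  obtain ⟨δ, hδ, hδ'⟩ := hT 0 0 (by simp [z₁]) (by simp [z₂]) 1 one_pos
  obtain ⟨η, hη, hηδ⟩ := exists_pos_ofReal_le hδ.ne'
  refine ⟨4 / η ^ 2, by positivity, fun f g X Y hX hY hf hg ↦ ?_⟩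
  have key : ∀ {N : 𝓢'(Rd d, ℂ) → ℝ≥0∞} {f : 𝓢(Rd d, ℂ)} {X : ℝ}, 0 < X →
      (∀ (c : ℂ) (f : 𝓢(Rd d, ℂ)), N (ofSchwartz (c • f)) ≤ ‖c‖ₑ * N (ofSchwartz f)) →
      N (ofSchwartz f) ≤ ENNReal.ofReal X →
      N (ofSchwartz (((η / (2 * X) : ℝ) : ℂ) • f)) < ENNReal.ofReal η := by
    intro N f X hX hN hf
    refine (hN _ f).trans_lt ?_
    rw [← ofReal_norm, Complex.norm_real, Real.norm_of_nonneg (by positivity)]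
    calc _ ≤ ENNReal.ofReal (η / (2 * X)) * ENNReal.ofReal X := by gcongr
      _ = ENNReal.ofReal (η / 2) := by
        rw [← ENNReal.ofReal_mul (by positivity)]; congr 1; field_simp
      _ < _ := (ENNReal.ofReal_lt_ofReal_iff hη).2 (by linarith)
  have k₁ := key hX h₁ hf
  have k₂ := key hY h₂ hg
  have h := hδ' _ _ (k₁.trans ENNReal.ofReal_lt_top) (k₂.trans ENNReal.ofReal_lt_top)
    (by rw [sub_zero]; exact k₁.trans_le hηδ) (by rw [sub_zero]; exact k₂.trans_le hηδ)
  -- Both factors were scaled to norm at most `η / 2`, and their product then has norm below 1;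
  -- undoing the scaling gives `4 X Y / η ^ 2`.
  have e : schwartzMul f g = ((4 / η ^ 2 * (X * Y) : ℝ) : ℂ) •
      schwartzMul (((η / (2 * X) : ℝ) : ℂ) • f) (((η / (2 * Y) : ℝ) : ℂ) • g) := by
    ext x
    have hX' : (X : ℂ) ≠ 0 := by exact_mod_cast hX.ne'
    have hY' : (Y : ℂ) ≠ 0 := by exact_mod_cast hY.ne'
    have hη' : (η : ℂ) ≠ 0 := by exact_mod_cast hη.ne'
    simp only [schwartzMul_apply, smul_apply, smul_eq_mul]
    push_cast
    field_simp
    ring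
  rw [hTmul, hT0, sub_zero] at h
  rw [e]
  refine (h₀ _ _).trans ((mul_le_mul_right h.le _).trans_eq ?_)
  rw [mul_one, ← ofReal_norm, Complex.norm_real, Real.norm_of_nonneg (by positivity)]

theorem IsAdaptedNorm.exists_bound {B : 𝓢(Rd d, ℂ)} {N₁ N₂ N₀ : 𝓢'(Rd d, ℂ) → ℝ≥0∞}
    {q₁ q₂ q₀ : ℝ≥0∞} {s₁ s₂ s₀ : ℝ} (h₁ : IsAdaptedNorm B N₁ q₁ s₁)
    (h₂ : IsAdaptedNorm B N₂ q₂ s₂) (h₀ : IsAdaptedNorm B N₀ q₀ s₀)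
    (h : ProductExtendsContinuously N₁ N₂ N₀) :
    ∃ r₀ : ℝ, 1 ≤ r₀ ∧ ∀ K : ℝ, 0 < K → ∃ C : ℝ, 0 < C ∧ ∀ (r : ℝ) (a b : Rd d), r₀ ≤ r →
      (∀ k : Rd d, ‖k‖ ≤ 1 / 2 → bracketPow s₁ (a + r • k) ≤ K * bracketPow s₁ a) →
      (∀ k : Rd d, ‖k‖ ≤ 1 / 2 → bracketPow s₂ (b + r • k) ≤ K * bracketPow s₂ b) →
      (∀ k : Rd d, ‖k‖ ≤ 1 / 2 → bracketPow s₀ (a + b) ≤ K * bracketPow s₀ (a + b + r • k)) →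
      r ^ ((d : ℝ) + d * q₀⁻¹.toReal) * bracketPow s₀ (a + b) ≤
        C * (r ^ ((d : ℝ) * q₁⁻¹.toReal + d * q₂⁻¹.toReal) *
          (bracketPow s₁ a * bracketPow s₂ b)) := by
  obtain ⟨M, hM, hbd⟩ := h.exists_bound h₁.smul h₂.smul h₀.smul
  obtain ⟨r₀, hr₀, hl⟩ := h₀.lower
  refine ⟨r₀, hr₀, fun K hK ↦ ?_⟩
  obtain ⟨c, hc, hl⟩ := hl K hK
  obtain ⟨C₁, hu₁⟩ := h₁.upper K
  obtain ⟨C₂, hu₂⟩ := h₂.upper K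
  refine ⟨c⁻¹ * (M * ((|C₁| + 1) * (|C₂| + 1))), by positivity, fun r a b hr k₁ k₂ k₀ ↦ ?_⟩
  have hr1 : 1 ≤ r := hr₀.trans hr
  have hr0 : 0 < r := by linarith
  have p₁ := bracketPow_pos s₁ a
  have p₂ := bracketPow_pos s₂ b
  set X := r ^ ((d : ℝ) * q₁⁻¹.toReal) * bracketPow s₁ a with hX
  set Y := r ^ ((d : ℝ) * q₂⁻¹.toReal) * bracketPow s₂ b with hY
  have hX0 : 0 < X := by positivity
  have hY0 : 0 < Y := by positivity
  have hle : ∀ C : ℝ, C ≤ |C| + 1 := fun C ↦ (le_abs_self C).trans (by linarith)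
  have h3 := hbd (testFunction B r a) (testFunction B r b) ((|C₁| + 1) * X) ((|C₂| + 1) * Y)
    (by positivity) (by positivity)
    ((hu₁ r a hr1 k₁).trans (ENNReal.ofReal_le_ofReal (by gcongr; exact hle _)))
    ((hu₂ r b hr1 k₂).trans (ENNReal.ofReal_le_ofReal (by gcongr; exact hle _)))
  have h4 := (ENNReal.ofReal_le_ofReal_iff (by positivity)).1 ((hl r a b hr k₀).trans h3)
  rw [mul_assoc c⁻¹, inv_mul_eq_div, le_div_iff₀ hc, Real.rpow_add hr0 (_ * _)]
  calc _ = c * (r ^ ((d : ℝ) + d * q₀⁻¹.toReal) * bracketPow s₀ (a + b)) := by ring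
    _ ≤ _ := h4
    _ = _ := by rw [hX, hY]; ring

theorem rpow_le_four_rpow_mul {x y : ℝ} (hx : 0 < x) (hy : 0 < y) (hxy : x ≤ 4 * y)
    (hyx : y ≤ 4 * x) (s : ℝ) : x ^ s ≤ 4 ^ |s| * y ^ s := by
  rcases le_total 0 s with hs | hs
  · rw [abs_of_nonneg hs, ← Real.mul_rpow (by norm_num) hy.le]
    exact Real.rpow_le_rpow hx.le hxy hs
  · rw [abs_of_nonpos hs, Real.rpow_neg (by norm_num), inv_mul_eq_div,
      le_div_iff₀ (by positivity), mul_comm, ← Real.mul_rpow (by norm_num) hx.le]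
    exact Real.rpow_le_rpow_of_nonpos hy hyx hs

theorem bracketPow_le_four_rpow_mul {x y : Rd d} (hxy : ‖x‖ ≤ 4 * ‖y‖) (hyx : ‖y‖ ≤ 4 * ‖x‖)
    (s : ℝ) : bracketPow s x ≤ 4 ^ |s| * bracketPow s y := by
  have key : ∀ {x y : Rd d}, ‖x‖ ≤ 4 * ‖y‖ → √(1 + ‖x‖ ^ 2) ≤ 4 * √(1 + ‖y‖ ^ 2) := by
    intro x y h
    rw [Real.sqrt_le_left (by positivity), mul_pow, Real.sq_sqrt (by positivity)]
    nlinarith [norm_nonneg x, norm_nonneg y]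
  exact rpow_le_four_rpow_mul (Real.sqrt_pos.2 (by positivity)) (Real.sqrt_pos.2 (by positivity))
    (key hxy) (key hyx) s

theorem bracketPow_comparable_rpow {x : Rd d} {r : ℝ} (hr : 1 ≤ r) (h1 : r ≤ ‖x‖)
    (h2 : ‖x‖ ≤ 2 * r) (s : ℝ) :
    bracketPow s x ≤ 4 ^ |s| * r ^ s ∧ r ^ s ≤ 4 ^ |s| * bracketPow s x := by
  have a1 : √(1 + ‖x‖ ^ 2) ≤ 4 * r := by
    rw [Real.sqrt_le_left (by positivity)]; nlinarith
  have a2 : r ≤ √(1 + ‖x‖ ^ 2) := Real.le_sqrt_of_sq_le (by nlinarith)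
  have a3 : 0 < √(1 + ‖x‖ ^ 2) := by linarith
  exact ⟨rpow_le_four_rpow_mul a3 (by linarith) a1 (by linarith) s,
    rpow_le_four_rpow_mul (by linarith) a3 (by linarith) a1 s⟩

theorem le_of_forall_rpow_le {α β C R₀ : ℝ} (h : ∀ R : ℝ, R₀ ≤ R → 1 ≤ R → R ^ α ≤ C * R ^ β) :
    α ≤ β := by
  by_contra! hlt
  have ht := tendsto_rpow_atTop (sub_pos.2 hlt)
  obtain ⟨R, h1, h2, h3⟩ := ((ht.eventually_gt_atTop C).and
    ((Filter.eventually_ge_atTop R₀).and (Filter.eventually_ge_atTop 1))).exists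
  have hR : 0 < R := by linarith
  rw [Real.rpow_sub hR, lt_div_iff₀ (by positivity)] at h1
  exact absurd (h R h2 h3) (not_le.2 h1)

/-- Here `q₀` and `s₀` belong to the target norm, so the main theorem applies this with the
conjugate exponent and the negated weight. -/
theorem IsAdaptedNorm.necessary {B : 𝓢(Rd d, ℂ)} {N₁ N₂ N₀ : 𝓢'(Rd d, ℂ) → ℝ≥0∞}
    {q₁ q₂ q₀ : ℝ≥0∞} {s₁ s₂ s₀ : ℝ} (hd : 1 ≤ d) (h₁ : IsAdaptedNorm B N₁ q₁ s₁)
    (h₂ : IsAdaptedNorm B N₂ q₂ s₂) (h₀ : IsAdaptedNorm B N₀ q₀ s₀)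
    (h : ProductExtendsContinuously N₁ N₂ N₀) :
    0 ≤ s₁ + s₂ ∧ s₀ ≤ s₁ ∧ s₀ ≤ s₂ ∧
      (d : ℝ) + d * q₀⁻¹.toReal + s₀ ≤ d * q₁⁻¹.toReal + d * q₂⁻¹.toReal + (s₁ + s₂) := by
  obtain ⟨r₀, hr₀, hb⟩ := h₁.exists_bound h₂ h₀ h
  have hr0 : 0 < r₀ := by linarith
  let e : Rd d := EuclideanSpace.single ⟨0, hd⟩ 1
  have he : ‖e‖ = 1 := by simp [e]
  have hRe : ∀ R : ℝ, 1 ≤ R → ‖R • e‖ = R := fun R hR ↦ by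
    rw [norm_smul, he, mul_one, Real.norm_of_nonneg (by linarith)]
  have hcmp : ∀ (s R : ℝ), 1 ≤ R →
      bracketPow s (R • e) ≤ 4 ^ |s| * R ^ s ∧ R ^ s ≤ 4 ^ |s| * bracketPow s (R • e) :=
    fun s R hR ↦ bracketPow_comparable_rpow hR (hRe R hR).ge (by rw [hRe R hR]; linarith) s
  -- bounds at the fixed scale `r₀`
  have hfix : ∃ C : ℝ, 0 < C ∧ ∀ a b : Rd d,
      bracketPow s₀ (a + b) ≤ C * (bracketPow s₁ a * bracketPow s₂ b) := by
    -- At a fixed scale Peetre's inequality gives comparability for every centre, and this `n`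
    -- serves all three weights.
    set n := ⌈|s₁|⌉₊ + ⌈|s₂|⌉₊ + ⌈|s₀|⌉₊ with hn
    have hK : ∀ s : ℝ, ⌈|s|⌉₊ ≤ n → ∀ a k : Rd d, ‖k‖ ≤ 1 / 2 →
        bracketPow s (a + r₀ • k) ≤ (1 + r₀) ^ n * bracketPow s a := by
      intro s hs a k hk
      have hp := bracketPow_pos s a
      refine (bracketPow_add_le_pow s a (r₀ • k)).trans ?_
      rw [mul_comm]
      gcongr
      have : ‖r₀ • k‖ ≤ r₀ := by
        rw [norm_smul, Real.norm_of_nonneg hr0.le]; nlinarith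
      calc (1 + ‖r₀ • k‖) ^ ⌈|s|⌉₊ ≤ (1 + r₀) ^ ⌈|s|⌉₊ := by gcongr
        _ ≤ _ := pow_le_pow_right₀ (by linarith) hs
    obtain ⟨C, hC, hb⟩ := hb ((1 + r₀) ^ n) (by positivity)
    set P := r₀ ^ ((d : ℝ) + d * q₀⁻¹.toReal)
    set Q := r₀ ^ ((d : ℝ) * q₁⁻¹.toReal + d * q₂⁻¹.toReal)
    have hP : 0 < P := by positivity
    have hQ : 0 < Q := by positivity
    refine ⟨P⁻¹ * (C * Q), by positivity, fun a b ↦ ?_⟩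
    have := hb r₀ a b le_rfl (fun k hk ↦ hK s₁ (by omega) a k hk)
      (fun k hk ↦ hK s₂ (by omega) b k hk) (fun k hk ↦ by
        -- The reverse comparison comes from moving back from the shifted point by `-k`.
        have := hK s₀ (by omega) (a + b + r₀ • k) (-k) (by rwa [norm_neg])
        rwa [smul_neg, add_neg_cancel_right] at this)
    rw [mul_assoc P⁻¹, inv_mul_eq_div, le_div_iff₀ hP]
    calc _ = P * bracketPow s₀ (a + b) := by ring
      _ ≤ _ := this
      _ = _ := by ring
  obtain ⟨C, hC, hfix⟩ := hfix
  refine ⟨?_, ?_, ?_, ?_⟩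
  -- Opposite high frequencies interact to give frequency zero.
  · refine le_of_forall_rpow_le (C := C * (4 ^ |s₁| * 4 ^ |s₂|)) (R₀ := 1) fun R _ hR ↦ ?_
    have h3 := hfix (R • e) (-(R • e))
    have hneg : bracketPow s₂ (-(R • e)) = bracketPow s₂ (R • e) := by simp [bracketPow]
    rw [add_neg_cancel, bracketPow_zero, hneg] at h3
    rw [Real.rpow_zero, Real.rpow_add (by linarith)]
    have p := bracketPow_pos s₂ (R • e)
    calc (1 : ℝ) ≤ C * (bracketPow s₁ (R • e) * bracketPow s₂ (R • e)) := h3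
      _ ≤ C * ((4 ^ |s₁| * R ^ s₁) * (4 ^ |s₂| * R ^ s₂)) := by
        gcongr
        exacts [(hcmp s₁ R hR).1, (hcmp s₂ R hR).1]
      _ = _ := by ring
  -- A high frequency is multiplied by a low one; the next case is symmetric.
  · refine le_of_forall_rpow_le (C := 4 ^ |s₀| * (C * 4 ^ |s₁|)) (R₀ := 1) fun R _ hR ↦ ?_
    have h3 := hfix (R • e) 0
    rw [add_zero, bracketPow_zero, mul_one] at h3
    calc R ^ s₀ ≤ 4 ^ |s₀| * bracketPow s₀ (R • e) := (hcmp s₀ R hR).2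
      _ ≤ 4 ^ |s₀| * (C * (4 ^ |s₁| * R ^ s₁)) := by
        gcongr
        exact h3.trans (by gcongr; exact (hcmp s₁ R hR).1)
      _ = _ := by ring
  · refine le_of_forall_rpow_le (C := 4 ^ |s₀| * (C * 4 ^ |s₂|)) (R₀ := 1) fun R _ hR ↦ ?_
    have h3 := hfix 0 (R • e)
    rw [zero_add, bracketPow_zero, one_mul] at h3
    calc R ^ s₀ ≤ 4 ^ |s₀| * bracketPow s₀ (R • e) := (hcmp s₀ R hR).2
      _ ≤ 4 ^ |s₀| * (C * (4 ^ |s₂| * R ^ s₂)) := by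
        gcongr
        exact h3.trans (by gcongr; exact (hcmp s₂ R hR).1)
      _ = _ := by ring
  -- Here `a = b = R e` and `r = R`. The centres `R e` and `2 R e` have norm at least `R`, while the
  -- balls have radius `R / 2`, so they stay away from the origin and all weights are comparable
  -- uniformly in `R`.
  · have hK : ∀ {s K : ℝ}, |s| ≤ K → ∀ {x y : Rd d}, ‖x‖ ≤ 4 * ‖y‖ → ‖y‖ ≤ 4 * ‖x‖ →
        bracketPow s x ≤ 4 ^ K * bracketPow s y := fun {s K} hs x y hxy hyx ↦
      (bracketPow_le_four_rpow_mul hxy hyx s).trans (mul_le_mul_of_nonneg_right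
        (Real.rpow_le_rpow_of_exponent_le (by norm_num) hs) (bracketPow_pos s y).le)
    have n₁ := abs_nonneg s₁
    have n₂ := abs_nonneg s₂
    have n₀ := abs_nonneg s₀
    obtain ⟨C, hC, hb⟩ := hb (4 ^ (|s₁| + |s₂| + |s₀|)) (by positivity)
    refine le_of_forall_rpow_le (C := 4 ^ |s₀| * (C * (4 ^ |s₁| * 4 ^ |s₂|))) (R₀ := r₀)
      fun R hR₀ hR ↦ ?_
    have hR0 : 0 < R := by linarith
    have hk : ∀ k : Rd d, ‖k‖ ≤ 1 / 2 → ‖R • k‖ ≤ R / 2 := fun k hk ↦ by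
      rw [norm_smul, Real.norm_of_nonneg hR0.le]; nlinarith
    have e1 := hRe R hR
    have e2 : ‖R • e + R • e‖ = 2 * R := by
      rw [← two_smul ℝ, norm_smul, e1]; norm_num
    have near : ∀ x k : Rd d, R ≤ ‖x‖ → ‖x‖ ≤ 2 * R → ‖k‖ ≤ 1 / 2 →
        ‖x + R • k‖ ≤ 4 * ‖x‖ ∧ ‖x‖ ≤ 4 * ‖x + R • k‖ := by
      intro x k hx hx' hk'
      have := hk k hk'
      have t1 := norm_add_le x (R • k)
      have t2 := norm_sub_le (x + R • k) (R • k)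
      rw [add_sub_cancel_right] at t2
      constructor <;> linarith
    have h3 := hb R (R • e) (R • e) hR₀
      (fun k hk' ↦ have t := near (R • e) k e1.ge (by linarith) hk'
        hK (by linarith) t.1 t.2)
      (fun k hk' ↦ have t := near (R • e) k e1.ge (by linarith) hk'
        hK (by linarith) t.1 t.2)
      (fun k hk' ↦ have t := near (R • e + R • e) k (by linarith) (by linarith) hk'
        hK (by linarith) t.2 t.1)
    have c0 := (bracketPow_comparable_rpow hR (x := R • e + R • e) (by linarith) (by linarith) s₀).2
    have p := bracketPow_pos s₂ (R • e)
    rw [Real.rpow_add hR0 _ s₀, Real.rpow_add hR0 _ (s₁ + s₂), Real.rpow_add hR0 s₁]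
    calc _ ≤ R ^ ((d : ℝ) + d * q₀⁻¹.toReal) *
          (4 ^ |s₀| * bracketPow s₀ (R • e + R • e)) := by gcongr
      _ = 4 ^ |s₀| * (R ^ ((d : ℝ) + d * q₀⁻¹.toReal) * bracketPow s₀ (R • e + R • e)) := by ring
      _ ≤ 4 ^ |s₀| * (C * (R ^ ((d : ℝ) * q₁⁻¹.toReal + d * q₂⁻¹.toReal) *
          ((4 ^ |s₁| * R ^ s₁) * (4 ^ |s₂| * R ^ s₂)))) := by
        gcongr 4 ^ |s₀| * ?_
        refine h3.trans ?_
        gcongr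
        exacts [(hcmp s₁ R hR).1, (hcmp s₂ R hR).1]
      _ = _ := by ring

/-! ### The Fourier Lebesgue norm is adapted -/

theorem integral_schwartzFourier_mul (f g : 𝓢(Rd d, ℂ)) :
    ∫ ξ, schwartzFourier d f ξ * g ξ = ∫ y, f y * schwartzFourier d g y := by
  have hint : Integrable (Function.uncurry fun (ξ y : Rd d) ↦ g ξ * f y * character ξ y)
      (volume.prod volume) := by
    refine ((g.integrable).mul_prod f.integrable).mul_bdd (c := 1) ?_
      (Filter.Eventually.of_forall fun z ↦ ?_)
    · refine Continuous.aestronglyMeasurable ?_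
      unfold character; fun_prop
    · simp [norm_character]
  have h := integral_integral_swap hint
  have e1 : ∀ ξ, schwartzFourier d f ξ * g ξ =
      fourierConst d * ∫ y, g ξ * f y * character ξ y := fun ξ ↦ by
    rw [schwartzFourier_eq_windowedFourier, windowedFourier, mul_assoc, ← integral_mul_const]
    congr 2; ext y; ring
  have e2 : ∀ y, f y * schwartzFourier d g y =
      fourierConst d * ∫ ξ, g ξ * f y * character ξ y := fun y ↦ by
    rw [schwartzFourier_eq_windowedFourier, windowedFourier, mul_left_comm, ← integral_const_mul]
    congr 2; ext ξ; rw [character_comm]; ring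
  simp_rw [e1, e2]
  rw [integral_const_mul, integral_const_mul, h]

/-- The weighted transform is itself Schwartz and is a candidate in the infimum. Any other candidate
is locally integrable, because `q ≥ 1`, and agrees with it almost everywhere by testing against
compactly supported smooth functions. -/
theorem fourierLebesgueNorm_ofSchwartz {q : ℝ≥0∞} (hq : 1 ≤ q) (s : ℝ) (f : 𝓢(Rd d, ℂ)) :
    fourierLebesgueNorm q s (ofSchwartz f) =
      eLpNorm (fun ξ ↦ (bracketPow s ξ : ℂ) * schwartzFourier d f ξ) q volume := by
  have hs := bracketPow_hasTemperateGrowth (d := d) s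
  set G : 𝓢(Rd d, ℂ) := SchwartzMap.smulLeftCLM ℂ (fun ξ : Rd d ↦ (bracketPow s ξ : ℂ))
    (schwartzFourier d f) with hG
  have hGap : ∀ ξ, G ξ = (bracketPow s ξ : ℂ) * schwartzFourier d f ξ := fun ξ ↦
    SchwartzMap.smulLeftCLM_apply_apply hs _ ξ
  have hu : ∀ ψ : 𝓢(Rd d, ℂ), TemperedDistribution.smulLeftCLM ℂ
      (fun ξ : Rd d ↦ (bracketPow s ξ : ℂ)) (temperedFourier d (ofSchwartz f)) ψ =
        ∫ x, ψ x * G x := by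
    intro ψ
    rw [TemperedDistribution.smulLeftCLM_apply_apply]
    change ofSchwartz f (schwartzFourier d _) = _
    rw [ofSchwartz_apply, integral_schwartzFourier_mul]
    congr 1; ext y
    rw [SchwartzMap.smulLeftCLM_apply_apply hs, hGap, smul_eq_mul]
    ring
  simp_rw [← hGap]
  refine le_antisymm (iInf₂_le (G : Rd d → ℂ) ⟨G.memLp q, hu⟩) (le_iInf₂ fun g hg ↦ ?_)
  refine (eLpNorm_congr_ae ?_).le
  refine ae_eq_of_integral_contDiff_smul_eq G.integrable.locallyIntegrable
    (hg.1.locallyIntegrable hq) fun ψ hψ hψ' ↦ ?_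
  have hsupp : HasCompactSupport fun k ↦ (ψ k : ℂ) :=
    hψ'.comp_left (g := ((↑) : ℝ → ℂ)) Complex.ofReal_zero
  have h1 := hu (hsupp.toSchwartzMap (Complex.ofRealCLM.contDiff.comp hψ))
  rw [hg.2] at h1
  exact h1.symm

/-- The point is that `L` does not depend on the translation `x`. -/
theorem exists_norm_sq_mul_sub_le (B : 𝓢(Rd d, ℂ)) (hB0 : B 0 = 1) (ψ : 𝓢(Rd d, ℂ)) :
    ∃ L, ∀ x y, ‖B y ^ 2 * ψ (y - x) - ψ (-x)‖ ≤ L * ‖y‖ := by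
  obtain ⟨L₁, h₁⟩ := exists_lipschitz (schwartzMul B B)
  obtain ⟨L₂, h₂⟩ := exists_lipschitz ψ
  obtain ⟨M, hM⟩ : ∃ M, ∀ k, ‖ψ k‖ ≤ M := ⟨_, SchwartzMap.norm_le_seminorm ℝ ψ⟩
  refine ⟨L₁ * M + L₂, fun x y ↦ ?_⟩
  have e : B y ^ 2 * ψ (y - x) - ψ (-x) =
      (B y ^ 2 - 1) * ψ (y - x) + (ψ (y - x) - ψ (-x)) := by ring
  have a1 : ‖B y ^ 2 - 1‖ ≤ L₁ * ‖y‖ := by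
    simpa [schwartzMul_apply, hB0, sq] using h₁ y 0
  have a2 : ‖ψ (y - x) - ψ (-x)‖ ≤ L₂ * ‖y‖ := by simpa using h₂ (y - x) (-x)
  rw [e]
  refine (norm_add_le _ _).trans ?_
  rw [norm_mul]
  calc _ ≤ (L₁ * ‖y‖) * M + L₂ * ‖y‖ := by
        gcongr
        · exact (norm_nonneg _).trans a1
        · exact hM _
    _ = _ := by ring

theorem exists_norm_sq_sub_one_le (B : 𝓢(Rd d, ℂ)) (hB0 : B 0 = 1) :
    ∃ L, ∀ y, ‖B y ^ 2 * 1 - 1‖ ≤ L * ‖y‖ := by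
  obtain ⟨L, h⟩ := exists_lipschitz (schwartzMul B B)
  exact ⟨L, fun y ↦ by simpa [schwartzMul_apply, hB0, sq] using h y 0⟩

theorem ofReal_toReal_eLpNorm_decayWeight {q : ℝ≥0∞} (hq : 1 ≤ q) :
    ENNReal.ofReal (eLpNorm (decayWeight : Rd d → ℝ) q volume).toReal =
      eLpNorm (decayWeight : Rd d → ℝ) q volume :=
  ENNReal.ofReal_toReal (memLp_decayWeight hq).eLpNorm_ne_top

/-- This is the case of the constant window 1, for which the transform of `B` is its profile and the
decay needed is that of a Schwartz function. -/
theorem isAdaptedNorm_fourierLebesgueNorm {B : 𝓢(Rd d, ℂ)} (hB0 : B 0 = 1)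
    (hB : ∀ k, 1 / 2 < ‖k‖ → B k = 0) (hB' : ∫ z, profile B z ^ 2 ≠ 0) {q : ℝ≥0∞} (hq : 1 ≤ q)
    (s : ℝ) : IsAdaptedNorm B (fourierLebesgueNorm q s) q s := by
  have hc := fourierConst_pos d
  have hq0 : q ≠ 0 := (one_pos.trans_le hq).ne'
  have hnorm : ∀ (f : 𝓢(Rd d, ℂ)) (ξ : Rd d), ‖(bracketPow s ξ : ℂ) * schwartzFourier d f ξ‖ =
      fourierConst d * (‖windowedFourier f (fun _ ↦ 1) ξ‖ * bracketPow s ξ) := fun f ξ ↦ by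
    rw [norm_mul, schwartzFourier_eq_windowedFourier, norm_mul, Complex.norm_real,
      Complex.norm_real, Real.norm_of_nonneg hc.le, Real.norm_of_nonneg (bracketPow_pos s ξ).le]
    ring
  refine ⟨fun c f ↦ ?_, fun K ↦ ?_, ?_⟩
  · rw [fourierLebesgueNorm_ofSchwartz hq, fourierLebesgueNorm_ofSchwartz hq, ← eLpNorm_const_smul]
    refine (congrArg (eLpNorm · q volume) ?_).le
    ext ξ
    simp only [map_smul, smul_apply, Pi.smul_apply, smul_eq_mul]
    ring
  · obtain ⟨C, hC0, hC⟩ := norm_windowedFourier_testFunction_le B hB s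
    obtain ⟨A, hA⟩ : ∃ A, ∀ η, ‖windowedFourier B (fun _ ↦ 1) η‖ *
        (1 + ‖η‖) ^ (⌈|s|⌉₊ + 2 * (d + 1)) ≤ A := by
      obtain ⟨A, hA⟩ : ∃ A, ∀ η : Rd d, (1 + ‖η‖) ^ (⌈|s|⌉₊ + 2 * (d + 1)) * ‖profile B η‖ ≤ A :=
        ⟨_, fun η ↦ by
          simpa using SchwartzMap.one_add_le_sup_seminorm_apply (𝕜 := ℝ)
            (m := (⌈|s|⌉₊ + 2 * (d + 1), 0)) le_rfl le_rfl (profile B) η⟩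
      refine ⟨A, fun η ↦ ?_⟩
      rw [mul_comm]
      simpa [profile_apply, windowedFourier] using hA η
    refine ⟨|fourierConst d * (C * A * K)| * (eLpNorm (decayWeight : Rd d → ℝ) q volume).toReal,
      fun r a hr hK ↦ ?_⟩
    have hr0 : 0 < r := by linarith
    have ha := bracketPow_pos s a
    rw [fourierLebesgueNorm_ofSchwartz hq]
    have h1 : eLpNorm (fun ξ ↦ (bracketPow s ξ : ℂ) * schwartzFourier d (testFunction B r a) ξ) q
        volume ≤ eLpNorm (fun ξ ↦ (fourierConst d * (C * A * K) * bracketPow s a) *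
          decayWeight (r⁻¹ • (ξ - a))) q volume := by
      refine eLpNorm_mono_real fun ξ ↦ ?_
      rw [hnorm]
      have := hC (fun _ ↦ 1) 1 A a ξ r K continuous_const (by simp) hA hr hK
      calc _ ≤ fourierConst d * (C * A * K * bracketPow s a * decayWeight (r⁻¹ • (ξ - a))) := by
            gcongr
        _ = _ := by ring
    refine h1.trans_eq ?_
    rw [eLpNorm_const_mul_real, eLpNorm_comp_smul_sub continuous_decayWeight hr0,
      ← ofReal_toReal_eLpNorm_decayWeight hq, ← ofReal_norm, Real.norm_eq_abs,
      ← ENNReal.ofReal_mul (by positivity), ← ENNReal.ofReal_mul (by positivity), abs_mul,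
      abs_of_pos ha]
    congr 1
    simp only [ENNReal.toReal_ofReal ENNReal.toReal_nonneg]
    ring
  · obtain ⟨L, hL⟩ := exists_norm_sq_sub_one_le B hB0
    obtain ⟨ρ, r₀, c, hρ, hρ', hr₀, hc', h⟩ := exists_lower_bound B hB' L 1 one_pos
    have hθ : 0 ≤ q⁻¹.toReal := ENNReal.toReal_nonneg
    have hball : volume (Metric.closedBall (0 : Rd d) ρ) ≠ 0 :=
      (Metric.measure_closedBall_pos volume _ hρ).ne'
    obtain ⟨v, hv, hv'⟩ := exists_pos_ofReal_le
      (X := volume (Metric.closedBall (0 : Rd d) ρ) ^ q⁻¹.toReal)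
      (by simp [ENNReal.rpow_eq_zero_iff, hball])
    refine ⟨r₀, hr₀, fun K hK ↦ ⟨fourierConst d * c * K⁻¹ * v, by positivity,
      fun r a b hr hcmp ↦ ?_⟩⟩
    have hr0 : 0 < r := by linarith
    have hab := bracketPow_pos s (a + b)
    rw [fourierLebesgueNorm_ofSchwartz hq]
    have h1 := le_eLpNorm_of_le_on (μ := volume) hq0
      (f := fun ξ ↦ (bracketPow s ξ : ℂ) * schwartzFourier d
        (schwartzMul (testFunction B r a) (testFunction B r b)) ξ)
      (S := Metric.closedBall (a + b) (r * ρ)) Metric.isClosed_closedBall.measurableSet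
      (Metric.measure_closedBall_pos volume _ (by positivity)).ne'
      (c := ENNReal.ofReal (fourierConst d * (c * r ^ d * (K⁻¹ * bracketPow s (a + b))))) ?_
    · refine le_trans ?_ h1
      rw [volume_closedBall_mul_rpow _ hr0 hρ hθ]
      refine le_trans (le_of_eq ?_) (mul_le_mul_right (mul_le_mul_right hv' _) _)
      rw [← ENNReal.ofReal_mul (by positivity), ← ENNReal.ofReal_mul (by positivity),
        Real.rpow_add hr0, Real.rpow_natCast]
      congr 1
      ring
    · intro ξ hξ
      obtain ⟨η, rfl⟩ : ∃ η, ξ = a + b + r • η := ⟨r⁻¹ • (ξ - (a + b)), by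
        rw [smul_smul, mul_inv_cancel₀ hr0.ne', one_smul, add_sub_cancel]⟩
      have hη : ‖η‖ ≤ ρ := by
        rw [mem_closedBall_iff_norm, add_sub_cancel_left, norm_smul, Real.norm_of_nonneg hr0.le]
          at hξ
        exact le_of_mul_le_mul_left hξ hr0
      rw [← ofReal_norm, hnorm]
      refine ENNReal.ofReal_le_ofReal ?_
      have h2 := h (fun _ ↦ 1) 1 r a b η continuous_const hL (by simp) (by simp) hr hη
      have h3 : K⁻¹ * bracketPow s (a + b) ≤ bracketPow s (a + b + r • η) := by
        rw [inv_mul_le_iff₀ hK]; exact hcmp η (hη.trans hρ')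
      gcongr

/-! ### The modulation and Wiener amalgam norms are adapted -/

/-- The Schwartz function `conj φ`. -/
def conjSchwartz (φ : 𝓢(Rd d, ℂ)) : 𝓢(Rd d, ℂ) :=
  SchwartzMap.postcompCLM (Complex.conjCLE : ℂ →L[ℝ] ℂ) φ

theorem conjSchwartz_apply (φ : 𝓢(Rd d, ℂ)) (x : Rd d) :
    conjSchwartz φ x = starRingEnd ℂ (φ x) := rfl

theorem norm_weightedStft_ofSchwartz (φ : 𝓢(Rd d, ℂ)) (s t : ℝ) (f : 𝓢(Rd d, ℂ)) (x ξ : Rd d) :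
    ‖weightedStft φ s t (ofSchwartz f) x ξ‖ = fourierConst d * bracketPow t x *
      (‖windowedFourier f (fun y ↦ conjSchwartz φ (y - x)) ξ‖ * bracketPow s ξ) := by
  simp only [weightedStft, stft_ofSchwartz_eq_windowedFourier, conjSchwartz_apply, norm_mul,
    Complex.norm_real, Real.norm_of_nonneg (fourierConst_pos d).le,
    Real.norm_of_nonneg (bracketPow_pos s ξ).le, Real.norm_of_nonneg (bracketPow_pos t x).le]
  ring

theorem weightedStft_smul (φ : 𝓢(Rd d, ℂ)) (s t : ℝ) (c : ℂ) (f : 𝓢(Rd d, ℂ)) (x ξ : Rd d) :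
    weightedStft φ s t (ofSchwartz (c • f)) x ξ = c * weightedStft φ s t (ofSchwartz f) x ξ := by
  rw [weightedStft, weightedStft, stft, stft, ofSchwartz_smul]
  simp only [smul_apply, smul_eq_mul]
  ring

/-- The bound separates `x` from `ξ`, which is why `M` and `W` can be treated alike. -/
theorem exists_norm_weightedStft_testFunction_le (B : 𝓢(Rd d, ℂ))
    (hB : ∀ k, 1 / 2 < ‖k‖ → B k = 0) (φ : 𝓢(Rd d, ℂ)) (s t : ℝ) :
    ∃ C : ℝ, ∀ (r K : ℝ) (a x ξ : Rd d), 1 ≤ r →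
      (∀ k : Rd d, ‖k‖ ≤ 1 / 2 → bracketPow s (a + r • k) ≤ K * bracketPow s a) →
      ‖weightedStft φ s t (ofSchwartz (testFunction B r a)) x ξ‖ ≤
        C * K * bracketPow s a * decayWeight x * decayWeight (r⁻¹ • (ξ - a)) := by
  obtain ⟨C, hC0, hC⟩ := norm_windowedFourier_testFunction_le B hB s
  obtain ⟨A, hA⟩ := exists_windowedFourier_decay (⌈|t|⌉₊ + (d + 1)) (⌈|s|⌉₊ + 2 * (d + 1)) B
    (conjSchwartz φ)
  obtain ⟨W, hW⟩ : ∃ W, ∀ k, ‖conjSchwartz φ k‖ ≤ W := ⟨_, SchwartzMap.norm_le_seminorm ℝ _⟩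
  have hc := fourierConst_pos d
  refine ⟨fourierConst d * C * A, fun r K a x ξ hr hK ↦ ?_⟩
  have ht := bracketPow_pos t x
  have hs := bracketPow_pos s ξ
  have hw : Continuous fun y ↦ conjSchwartz φ (y - x) :=
    (conjSchwartz φ).continuous.comp (by fun_prop)
  -- Of the decay in `x`, `⌈|t|⌉₊` powers absorb the weight `⟨x⟩ ^ t` and `d + 1` produce
  -- `decayWeight x`.
  have h := hC (fun y ↦ conjSchwartz φ (y - x)) W (A / (1 + ‖x‖) ^ (⌈|t|⌉₊ + (d + 1))) a ξ r K
    hw (fun y ↦ hW _) (fun η ↦ by rw [le_div_iff₀ (by positivity)]; exact hA x η) hr hK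
  have hpos : 0 ≤ C * (A / (1 + ‖x‖) ^ (⌈|t|⌉₊ + (d + 1))) * K * bracketPow s a *
      decayWeight (r⁻¹ • (ξ - a)) := le_trans (by positivity) h
  rw [norm_weightedStft_ofSchwartz]
  calc _ ≤ fourierConst d * (1 + ‖x‖) ^ ⌈|t|⌉₊ *
        (C * (A / (1 + ‖x‖) ^ (⌈|t|⌉₊ + (d + 1))) * K * bracketPow s a *
          decayWeight (r⁻¹ • (ξ - a))) := by
        gcongr
        exact bracketPow_le_pow t x
    _ = _ := by
        rw [decayWeight.eq_def x, pow_add]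
        field_simp

/-- The product concentrates at `y = 0`, where the window translated by `x` has modulus `|φ(-x)|`.
So `S` is a set of `x` near the reflection of a point where `φ` does not vanish, independent of `r`,
`a` and `b`. -/
theorem exists_le_norm_weightedStft_mul_testFunction {B : 𝓢(Rd d, ℂ)} (hB0 : B 0 = 1)
    (hB' : ∫ z, profile B z ^ 2 ≠ 0) {φ : 𝓢(Rd d, ℂ)} (hφ : φ ≠ 0) (s t : ℝ) :
    ∃ (S : Set (Rd d)) (ρ r₀ c : ℝ), MeasurableSet S ∧ volume S ≠ 0 ∧ 0 < ρ ∧ 1 ≤ r₀ ∧ 0 < c ∧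
      ∀ (K r : ℝ) (a b : Rd d), 0 < K → r₀ ≤ r →
        (∀ k : Rd d, ‖k‖ ≤ 1 / 2 → bracketPow s (a + b) ≤ K * bracketPow s (a + b + r • k)) →
        ∀ x ∈ S, ∀ ξ ∈ Metric.closedBall (a + b) (r * ρ),
          ENNReal.ofReal (c * K⁻¹ * (r ^ (d : ℝ) * bracketPow s (a + b))) ≤
            ‖weightedStft φ s t
              (ofSchwartz (schwartzMul (testFunction B r a) (testFunction B r b))) x ξ‖ₑ := by
  have hc := fourierConst_pos d
  obtain ⟨x₁, hx₁⟩ : ∃ x, φ x ≠ 0 := by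
    by_contra! h
    exact hφ (SchwartzMap.ext h)
  have hnorm : ∀ x, ‖conjSchwartz φ x‖ = ‖φ x‖ := fun x ↦ by
    rw [conjSchwartz_apply, RCLike.norm_conj]
  have hδ : 0 < ‖φ x₁‖ / 2 := by positivity
  obtain ⟨M, hM⟩ : ∃ M, ∀ k, ‖conjSchwartz φ k‖ ≤ M := ⟨_, SchwartzMap.norm_le_seminorm ℝ _⟩
  obtain ⟨L, hL⟩ := exists_norm_sq_mul_sub_le B hB0 (conjSchwartz φ)
  obtain ⟨ρ, r₀, c, hρ, hρ', hr₀, hc', h⟩ := exists_lower_bound B hB' L M hδ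
  have ht₁ := bracketPow_pos t (-x₁)
  have hopen : IsOpen {x : Rd d | ‖φ x₁‖ / 2 < ‖φ (-x)‖ ∧ bracketPow t (-x₁) / 2 < bracketPow t x} :=
    (isOpen_lt continuous_const (φ.continuous.comp continuous_neg).norm).inter
      (isOpen_lt continuous_const (continuous_bracketPow t))
  refine ⟨_, ρ, r₀, fourierConst d * (bracketPow t (-x₁) / 2) * c, hopen.measurableSet,
    (hopen.measure_pos volume ⟨-x₁, ?_, ?_⟩).ne', hρ, hr₀, by positivity,
    fun K r a b hK hr hcmp x hx ξ hξ ↦ ?_⟩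
  · rw [neg_neg]; linarith [norm_pos_iff.2 hx₁]
  · linarith
  have hr0 : 0 < r := by linarith
  have hab := bracketPow_pos s (a + b)
  obtain ⟨η, rfl⟩ : ∃ η, ξ = a + b + r • η := ⟨r⁻¹ • (ξ - (a + b)), by
    rw [smul_smul, mul_inv_cancel₀ hr0.ne', one_smul, add_sub_cancel]⟩
  have hη : ‖η‖ ≤ ρ := by
    rw [mem_closedBall_iff_norm, add_sub_cancel_left, norm_smul, Real.norm_of_nonneg hr0.le] at hξ
    exact le_of_mul_le_mul_left hξ hr0
  have hw : Continuous fun y ↦ conjSchwartz φ (y - x) :=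
    (conjSchwartz φ).continuous.comp (by fun_prop)
  have h2 := h (fun y ↦ conjSchwartz φ (y - x)) (conjSchwartz φ (-x)) r a b η hw (hL x)
    (by rw [hnorm]; exact hx.1.le) (hM _) hr hη
  have h3 : K⁻¹ * bracketPow s (a + b) ≤ bracketPow s (a + b + r • η) := by
    rw [inv_mul_le_iff₀ hK]; exact hcmp η (hη.trans hρ')
  rw [← ofReal_norm, norm_weightedStft_ofSchwartz]
  refine ENNReal.ofReal_le_ofReal ?_
  have hx2 := hx.2
  calc _ = fourierConst d * (bracketPow t (-x₁) / 2) *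
        ((c * r ^ d) * (K⁻¹ * bracketPow s (a + b))) := by rw [Real.rpow_natCast]; ring
    _ ≤ _ := by
      have := bracketPow_pos t x
      gcongr

theorem exists_pos_ofReal_le_rpow {α : Type*} [MeasurableSpace α] {μ : Measure α} {S : Set α}
    (hS : μ S ≠ 0) (q : ℝ≥0∞) : ∃ v : ℝ, 0 < v ∧ ENNReal.ofReal v ≤ μ S ^ q⁻¹.toReal :=
  exists_pos_ofReal_le (by simp [ENNReal.rpow_eq_zero_iff, hS])

theorem eLpNorm_eLpNorm_const_mul_le {α β : Type*} [MeasurableSpace α] [MeasurableSpace β]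
    {μ : Measure α} {ν : Measure β} (c : ℂ) (F : α → β → ℂ) (p q : ℝ≥0∞) :
    eLpNorm (fun y ↦ eLpNorm (fun x ↦ c * F x y) p μ) q ν ≤
      ‖c‖ₑ * eLpNorm (fun y ↦ eLpNorm (fun x ↦ F x y) p μ) q ν := by
  have h : ∀ y, eLpNorm (fun x ↦ c * F x y) p μ = ‖c‖ₑ * eLpNorm (fun x ↦ F x y) p μ := fun y ↦
    eLpNorm_const_smul c (fun x ↦ F x y) p μ
  simp_rw [h]
  exact eLpNorm_le_nnreal_smul_eLpNorm_of_ae_le_mul' (c := ‖c‖₊)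
    (Filter.Eventually.of_forall fun y ↦ le_rfl) q

theorem isAdaptedNorm_modulationNorm {B : 𝓢(Rd d, ℂ)} (hB0 : B 0 = 1)
    (hB : ∀ k, 1 / 2 < ‖k‖ → B k = 0) (hB' : ∫ z, profile B z ^ 2 ≠ 0) {φ : 𝓢(Rd d, ℂ)}
    (hφ : φ ≠ 0) {p q : ℝ≥0∞} (hp : 1 ≤ p) (hq : 1 ≤ q) (s t : ℝ) :
    IsAdaptedNorm B (modulationNorm φ p q s t) q s := by
  have hp0 : p ≠ 0 := (one_pos.trans_le hp).ne'
  have hq0 : q ≠ 0 := (one_pos.trans_le hq).ne'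
  refine ⟨fun c f ↦ ?_, fun K ↦ ?_, ?_⟩
  · simp_rw [modulationNorm, weightedStft_smul]
    exact eLpNorm_eLpNorm_const_mul_le c _ p q
  · obtain ⟨C, hC⟩ := exists_norm_weightedStft_testFunction_le B hB φ s t
    refine ⟨|C * K| * (eLpNorm (decayWeight : Rd d → ℝ) p volume).toReal *
      (eLpNorm (decayWeight : Rd d → ℝ) q volume).toReal, fun r a hr hK ↦ ?_⟩
    have hr0 : 0 < r := by linarith
    have ha := bracketPow_pos s a
    refine (eLpNorm_eLpNorm_le_of_norm_le (fun x ξ ↦ hC r K a x ξ hr hK) p q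
      (memLp_decayWeight hp).eLpNorm_ne_top).trans_eq ?_
    rw [eLpNorm_comp_smul_sub continuous_decayWeight hr0,
      ← ofReal_toReal_eLpNorm_decayWeight hp, ← ofReal_toReal_eLpNorm_decayWeight hq,
      ← ofReal_norm, Real.norm_eq_abs, ← ENNReal.ofReal_mul (by positivity),
      ← ENNReal.ofReal_mul (by positivity), ← ENNReal.ofReal_mul (by positivity), abs_mul,
      abs_of_pos ha]
    congr 1
    simp only [ENNReal.toReal_ofReal ENNReal.toReal_nonneg]
    ring
  · obtain ⟨S, ρ, r₀, c, hS, hS0, hρ, hr₀, hc, h⟩ :=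
      exists_le_norm_weightedStft_mul_testFunction hB0 hB' hφ s t
    have hθ : 0 ≤ q⁻¹.toReal := ENNReal.toReal_nonneg
    obtain ⟨v, hv, hv'⟩ := exists_pos_ofReal_le_rpow hS0 p
    obtain ⟨u, hu, hu'⟩ := exists_pos_ofReal_le_rpow
      (Metric.measure_closedBall_pos volume (0 : Rd d) hρ).ne' q
    refine ⟨r₀, hr₀, fun K hK ↦ ⟨c * K⁻¹ * v * u, by positivity, fun r a b hr hcmp ↦ ?_⟩⟩
    have hr0 : 0 < r := by linarith
    have hab := bracketPow_pos s (a + b)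
    refine le_trans ?_ (le_eLpNorm_eLpNorm_of_le_on hp0 hq0 hS
      Metric.isClosed_closedBall.measurableSet hS0
      (Metric.measure_closedBall_pos volume _ (by positivity)).ne' (h K r a b hK hr hcmp))
    rw [volume_closedBall_mul_rpow _ hr0 hρ hθ]
    refine le_trans (le_of_eq ?_) (mul_le_mul' (mul_le_mul_right hv' _) (mul_le_mul_right hu' _))
    rw [← ENNReal.ofReal_mul (by positivity), ← ENNReal.ofReal_mul (by positivity),
      ← ENNReal.ofReal_mul (by positivity), Real.rpow_add hr0]
    congr 1
    ring

theorem isAdaptedNorm_wienerNorm {B : 𝓢(Rd d, ℂ)} (hB0 : B 0 = 1)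
    (hB : ∀ k, 1 / 2 < ‖k‖ → B k = 0) (hB' : ∫ z, profile B z ^ 2 ≠ 0) {φ : 𝓢(Rd d, ℂ)}
    (hφ : φ ≠ 0) {p q : ℝ≥0∞} (hp : 1 ≤ p) (hq : 1 ≤ q) (s t : ℝ) :
    IsAdaptedNorm B (wienerNorm φ p q s t) q s := by
  have hp0 : p ≠ 0 := (one_pos.trans_le hp).ne'
  have hq0 : q ≠ 0 := (one_pos.trans_le hq).ne'
  refine ⟨fun c f ↦ ?_, fun K ↦ ?_, ?_⟩
  · simp_rw [wienerNorm, weightedStft_smul]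
    exact eLpNorm_eLpNorm_const_mul_le c (fun ξ x ↦ weightedStft φ s t (ofSchwartz f) x ξ) q p
  · obtain ⟨C, hC⟩ := exists_norm_weightedStft_testFunction_le B hB φ s t
    refine ⟨|C * K| * (eLpNorm (decayWeight : Rd d → ℝ) p volume).toReal *
      (eLpNorm (decayWeight : Rd d → ℝ) q volume).toReal, fun r a hr hK ↦ ?_⟩
    have hr0 : 0 < r := by linarith
    have ha := bracketPow_pos s a
    have hsc := eLpNorm_comp_smul_sub (q := q) (continuous_decayWeight (d := d)) hr0 a
    -- The inner norm is now in `ξ`, so the dilated weight takes the inner place and its norm must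
    -- be shown finite.
    refine (eLpNorm_eLpNorm_le_of_norm_le (g := fun ξ ↦ decayWeight (r⁻¹ • (ξ - a)))
      (h := decayWeight) (fun ξ x ↦ (hC r K a x ξ hr hK).trans_eq (mul_right_comm _ _ _)) q p
      ?_).trans_eq ?_
    · rw [hsc]
      exact ENNReal.mul_ne_top ENNReal.ofReal_ne_top (memLp_decayWeight hq).eLpNorm_ne_top
    rw [hsc, ← ofReal_toReal_eLpNorm_decayWeight hp, ← ofReal_toReal_eLpNorm_decayWeight hq,
      ← ofReal_norm, Real.norm_eq_abs, ← ENNReal.ofReal_mul (by positivity),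
      ← ENNReal.ofReal_mul (by positivity), ← ENNReal.ofReal_mul (by positivity), abs_mul,
      abs_of_pos ha]
    congr 1
    simp only [ENNReal.toReal_ofReal ENNReal.toReal_nonneg]
    ring
  · obtain ⟨S, ρ, r₀, c, hS, hS0, hρ, hr₀, hc, h⟩ :=
      exists_le_norm_weightedStft_mul_testFunction hB0 hB' hφ s t
    have hθ : 0 ≤ q⁻¹.toReal := ENNReal.toReal_nonneg
    obtain ⟨v, hv, hv'⟩ := exists_pos_ofReal_le_rpow hS0 p
    obtain ⟨u, hu, hu'⟩ := exists_pos_ofReal_le_rpow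
      (Metric.measure_closedBall_pos volume (0 : Rd d) hρ).ne' q
    refine ⟨r₀, hr₀, fun K hK ↦ ⟨c * K⁻¹ * v * u, by positivity, fun r a b hr hcmp ↦ ?_⟩⟩
    have hr0 : 0 < r := by linarith
    have hab := bracketPow_pos s (a + b)
    refine le_trans ?_ (le_eLpNorm_eLpNorm_of_le_on hq0 hp0
      Metric.isClosed_closedBall.measurableSet hS
      (Metric.measure_closedBall_pos volume _ (by positivity)).ne' hS0
      fun ξ hξ x hx ↦ h K r a b hK hr hcmp x hx ξ hξ)
    rw [volume_closedBall_mul_rpow _ hr0 hρ hθ]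
    refine le_trans (le_of_eq ?_) (mul_le_mul' (mul_le_mul_right (mul_le_mul_right hu' _) _) hv')
    rw [← ENNReal.ofReal_mul (by positivity), ← ENNReal.ofReal_mul (by positivity),
      ← ENNReal.ofReal_mul (by positivity), Real.rpow_add hr0]
    congr 1
    ring

theorem one_le_conjExponent (q : ℝ≥0∞) : 1 ≤ q.conjExponent := le_self_add

end FourierMod

end

/-! ### The main theorem -/

theorem proposition3p7 (d : ℕ) (hd : 1 ≤ d) (φ : 𝓢(Rd d, ℂ)) (hφ : φ ≠ 0)
    (p q : Fin 3 → ℝ≥0∞) (hp : ∀ j, 1 ≤ p j) (hq : ∀ j, 1 ≤ q j) (s t : Fin 3 → ℝ)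
    (h :
      FourierMod.ProductExtendsContinuously (d := d)
        (FourierMod.fourierLebesgueNorm (q 1) (s 1))
        (FourierMod.fourierLebesgueNorm (q 2) (s 2))
        (FourierMod.fourierLebesgueNorm (q 0).conjExponent (-s 0)) ∨
      FourierMod.ProductExtendsContinuously
        (FourierMod.modulationNorm φ (p 1) (q 1) (s 1) (t 1))
        (FourierMod.modulationNorm φ (p 2) (q 2) (s 2) (t 2))
        (FourierMod.modulationNorm φ (p 0).conjExponent (q 0).conjExponent (-s 0) (-t 0)) ∨
      FourierMod.ProductExtendsContinuously
        (FourierMod.wienerNorm φ (p 1) (q 1) (s 1) (t 1))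
        (FourierMod.wienerNorm φ (p 2) (q 2) (s 2) (t 2))
        (FourierMod.wienerNorm φ (p 0).conjExponent (q 0).conjExponent (-s 0) (-t 0))) :
    (∀ j k : Fin 3, j ≠ k → 0 ≤ s j + s k) ∧
      0 ≤ s 0 + s 1 + s 2 - d * FourierMod.youngFunctional q := by
  open FourierMod in
  obtain ⟨B, hB0, hB, hB'⟩ := exists_bump d
  have hp' := one_le_conjExponent (p 0)
  have hq' := one_le_conjExponent (q 0)
  have key : 0 ≤ s 1 + s 2 ∧ -s 0 ≤ s 1 ∧ -s 0 ≤ s 2 ∧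
      (d : ℝ) + d * (q 0).conjExponent⁻¹.toReal + -s 0 ≤
        d * (q 1)⁻¹.toReal + d * (q 2)⁻¹.toReal + (s 1 + s 2) := by
    rcases h with h | h | h
    · have key := fun {q : ℝ≥0∞} (hq : 1 ≤ q) ↦ isAdaptedNorm_fourierLebesgueNorm hB0 hB hB' hq
      exact (key (hq 1) _).necessary hd (key (hq 2) _) (key hq' _) h
    · have key := fun {p q : ℝ≥0∞} (hp : 1 ≤ p) (hq : 1 ≤ q) ↦
        isAdaptedNorm_modulationNorm hB0 hB hB' hφ hp hq
      exact (key (hp 1) (hq 1) _ _).necessary hd (key (hp 2) (hq 2) _ _) (key hp' hq' _ _) h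
    · have key := fun {p q : ℝ≥0∞} (hp : 1 ≤ p) (hq : 1 ≤ q) ↦
        isAdaptedNorm_wienerNorm hB0 hB hB' hφ hp hq
      exact (key (hp 1) (hq 1) _ _).necessary hd (key (hp 2) (hq 2) _ _) (key hp' hq' _ _) h
  obtain ⟨h12, h01, h02, hR⟩ := key
  refine ⟨fun j k hjk ↦ ?_, ?_⟩
  · fin_cases j <;> fin_cases k <;> first | exact absurd rfl hjk | (simp; linarith)
  -- Substituting `1/q₀' = 1 - 1/q₀` turns `d + d/q₀'` into `2d - d/q₀`, which produces the Young
  -- functional.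
  · rw [toReal_inv_conjExponent (hq 0)] at hR
    rw [youngFunctional]
    linarith
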